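/- Let $\mathcal O\subset\mathbb R^n$ be a bounded convex domain with smooth boundary, let $I=[0,1]$, and fix $p\in\mathbb R^n\setminus\overline{\mathcal O}$. For $q\in\mathbb R^n\setminus\overline{\mathcal O}$ let $$\mathcal A_{p,q}=\{u\in H^1(I,\mathbb R^n): u(0)=p,\ u(1)=q,\ u(t)\notin\mathcal O\text{ for all }t\in I\},\qquad E(u)=\int_I|u'(t)|^2\,dt,$$ where elements of $H^1(I,\mathbb R^n)$ are identified with their continuous representatives. Let $\mathcal S_1$ be the set of $q\in\mathbb R^n\setminus\overline{\mathcal O}$ for which $E$ has exactly one minimizer over $\mathcal A_{p,q}$, and let $\mathcal S_2$ be the set of $q\in\mathbb R^n\setminus\overline{\mathcal O}$ for which $E$ has at least two different minimizers over $\mathcal A_{p,q}$. Then $\mathcal S_2\subset\partial\mathcal S_1$, and in particular $\operatorname{int}(\mathcal S_2)=\emptyset$. Moreover, let $q\in\mathbb R^n\setminus\overline{\mathcal O}$ be such that the line segment from $p$ to $q$ meets $\mathcal O$, and let $u$ be a minimizer of $E$ over $\mathcal A_{p,q}$. Then there is a last time $b\in I$ with $u(b)\in\partial\mathcal O$, and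 every point $q'$ strictly between $u(b)$ and $q$ on the line segment joining them belongs to $\mathcal S_1$ (in particular $q'\notin\overline{\mathcal O}$). -/

import Mathlib

noncomputable section

namespace Obstacle

open MeasureTheory Set
open scoped ContDiff unitInterval

variable {E : Type*} [NormedAddCommGroup E] [InnerProductSpace ℝ E]

/-- `O` has smooth boundary: near each boundary point `O` is the sublevel set `{ρ < 0}` of a
smooth function `ρ` whose differential does not vanish at that point. -/
def HasSmoothBoundary (O : Set E) : Prop :=
  ∀ x ∈ frontier O, ∃ (U : Set E) (ρ : E → ℝ),
    IsOpen U ∧ x ∈ U ∧ ContDiffOn ℝ ∞ ρ U ∧ fderiv ℝ ρ x ≠ 0 ∧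
      ∀ y ∈ U, y ∈ O ↔ ρ y < 0

/-- A bounded convex domain (nonempty, open; connected since convex) with smooth boundary. -/
structure IsSmoothConvexObstacle (O : Set E) : Prop where
  nonempty : O.Nonempty
  isOpen : IsOpen O
  convex : Convex ℝ O
  bounded : Bornology.IsBounded O
  smooth : HasSmoothBoundary O

/-- `g` is a weak derivative of `u` on the interval `I = [0,1]`: integration by parts holds
against every smooth real function compactly supported in `(0,1)`. -/
def IsWeakDeriv (u g : I → E) : Prop :=
  ∀ φ : ℝ → ℝ, ContDiff ℝ ∞ φ → tsupport φ ⊆ Ioo 0 1 →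
    ∫ t : I, deriv φ (t : ℝ) • u t = -∫ t : I, φ (t : ℝ) • g t

variable (E) in
/-- The Sobolev space `H¹(I, E)` of the interval `I = [0,1]`. An element is given by its
continuous representative (each class has exactly one) and its weak derivative, an element of
`L²(I, E)`, which is determined by the former. -/
structure H1 where
  toFun : C(I, E)
  weakDeriv : Lp E 2 (volume : Measure I)
  isWeakDeriv : IsWeakDeriv toFun weakDeriv

instance : CoeFun (H1 E) (fun _ => I → E) := ⟨fun u => u.toFun⟩

/-- An element of `H¹(I, E)` is determined by its continuous representative. -/
theorem H1.ext_toFun [CompleteSpace E] {u v : H1 E} (h : u.toFun = v.toFun) : u = v := by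
  have key : u.weakDeriv = v.weakDeriv := by
    have hu := u.isWeakDeriv
    have hv := v.isWeakDeriv
    have iu : Integrable (u.weakDeriv : I → E) volume := (Lp.memLp u.weakDeriv).integrable (by norm_num)
    have iv : Integrable (v.weakDeriv : I → E) volume := (Lp.memLp v.weakDeriv).integrable (by norm_num)
    set d : I → E := fun t => u.weakDeriv t - v.weakDeriv t with hd
    have hdi : Integrable d volume := iu.sub iv
    have hz : ∀ φ : ℝ → ℝ, ContDiff ℝ ∞ φ → tsupport φ ⊆ Ioo 0 1 → ∫ t : I, φ (t:ℝ) • d t = 0 := by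
      intro φ h1 h2
      have a := hu φ h1 h2
      have b := hv φ h1 h2
      rw [h, b, neg_inj] at a
      obtain ⟨C, hC⟩ := (isCompact_Icc (a := (0:ℝ)) (b := 1)).exists_bound_of_continuousOn h1.continuous.continuousOn
      have sm : ∀ g : I → E, Integrable g volume → Integrable (fun t : I => φ (t:ℝ) • g t) volume := by
        intro g hg
        exact hg.bdd_smul C (φ := fun t : I => φ (t:ℝ)) (h1.continuous.comp continuous_subtype_val).aestronglyMeasurable
          (Filter.Eventually.of_forall fun t => hC t t.2)
      simp only [hd, smul_sub]
      rw [integral_sub (sm _ iu) (sm _ iv), a, sub_self]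
    let f : ℝ → E := fun x => d (projIcc 0 1 zero_le_one x)
    have hf : ∀ t : I, f t = d t := fun t => by simp [f]
    have emb : MeasurableEmbedding (Subtype.val : I → ℝ) := MeasurableEmbedding.subtype_coe measurableSet_Icc
    have hmap : Measure.map (Subtype.val : I → ℝ) volume = volume.restrict (Icc 0 1) :=
      map_comap_subtype_coe measurableSet_Icc volume
    have fi : IntegrableOn f (Icc 0 1) volume := by
      rw [IntegrableOn, ← hmap, emb.integrable_map_iff]
      exact hdi.congr (Filter.Eventually.of_forall fun t => (hf t).symm)
    have hae := isOpen_Ioo.ae_eq_zero_of_integral_contDiff_smul_eq_zero (U := Ioo (0:ℝ) 1) (f := f) (μ := volume)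
      ((fi.mono_set Ioo_subset_Icc_self).locallyIntegrableOn) (by
        intro g g1 _ g3
        have := hz g g1 g3
        rw [← setIntegral_eq_integral_of_forall_compl_eq_zero (s := Icc (0:ℝ) 1)]
        · rw [← hmap, emb.integral_map]
          simpa [hf] using this
        · intro x hx
          have : g x = 0 := image_eq_zero_of_notMem_tsupport fun hx' => hx (Ioo_subset_Icc_self (g3 hx'))
          simp [this])
    have h3 : ∀ᵐ x ∂(volume.restrict (Icc (0:ℝ) 1)), f x = 0 := by
      rw [← restrict_Ioo_eq_restrict_Icc, ae_restrict_iff' measurableSet_Ioo]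
      exact hae
    rw [← hmap, emb.ae_map_iff] at h3
    apply Lp.ext
    filter_upwards [h3] with t ht
    rw [hf] at ht
    exact sub_eq_zero.1 ht
  cases u; cases v; simp_all

/-- The energy `E(u) = ∫_I |u'(t)|² dt`. -/
def energy (u : H1 E) : ℝ := ∫ t : I, ‖u.weakDeriv t‖ ^ 2

/-- The admissible set `𝒜` of `H¹` curves from `p` to `q` that stay in the complement of `O`. -/
def admissible (O : Set E) (p q : E) : Set (H1 E) :=
  {u | u 0 = p ∧ u 1 = q ∧ ∀ t : I, u t ∉ O}

/-- `u` minimizes the energy over the admissible set. -/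
def IsMinimizer (O : Set E) (p q : E) (u : H1 E) : Prop :=
  u ∈ admissible O p q ∧ ∀ v ∈ admissible O p q, energy u ≤ energy v

/-- The endpoints `q` outside `closure O` for which there is exactly one minimizer. -/
def uniqueSet (O : Set E) (p : E) : Set E :=
  {q | q ∉ closure O ∧ ∃! u : H1 E, IsMinimizer O p q u}

/-- The endpoints `q` outside `closure O` for which there are at least two minimizers. -/
def nonuniqueSet (O : Set E) (p : E) : Set E :=
  {q | q ∉ closure O ∧ ∃ u v : H1 E, IsMinimizer O p q u ∧ IsMinimizer O p q v ∧ u ≠ v}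

end Obstacle

end

/-! The heart of the matter is that minimizers do not branch backwards in time: two minimizers from
`p` to `q` that agree on some `[s, 1]` with `s < 1` agree on `[0, 1]`
(`IsMinCurve.eqOn_of_eqOn_final`). Given this, let `u` be a minimizer and `0 < s < 1`. Any minimizer
ending at `u s`, followed by the rest of `u`, is again a minimizer to `q` and shares its tail with
`u`; so the minimizer to `u s` is unique. Two distinct minimizers to `q` can exist only if the
segment from `p` to `q` meets `O`, and then each of them touches `O`. After its last contact a
minimizer is affine, so the points of its last segment lie in `uniqueSet` and accumulate at `q`.

For the backward uniqueness, a minimizer is affine off the obstacle, and convexity makes its contact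
times an interval. On contact intervals an ODE is needed, and regularity of the velocity has to be
proved, not assumed. Through every `x ∉ O` passes a hyperplane missing `O`, with normal `a x` taken
from the gauge of `O` centred at some `o ∈ O` and normalized by `⟪a x, x - o⟫ = 1`. Variations
tangent to these hyperplanes are admissible with both signs, so the constrained problem yields an
equality: the momentum `g - ⟪u - o, g⟫ • a u` is a primitive of an integrable force, hence has a
continuous representative (`IsMinCurve.exists_momentum`). In contact the velocity is orthogonal to
`a u` and is recovered from the momentum by projection, so position and momentum solve an ODE with a
`C¹` right-hand side, which has backward uniqueness. -/

noncomputable section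

namespace Obstacle

open MeasureTheory Set Filter Topology
open scoped ContDiff unitInterval RealInnerProductSpace

/-! ### Absolutely continuous curves as primitives, and the du Bois-Reymond lemma. -/

section Primitive

variable {F : Type*} [NormedAddCommGroup F] [NormedSpace ℝ F]

/-- `u` is a primitive on `[c, d]` of the integrable function `g`. -/
structure IsPrimitiveOn (u g : ℝ → F) (c d : ℝ) : Prop where
  le : c ≤ d
  integrable : IntervalIntegrable g volume c d
  eq : ∀ t ∈ Icc c d, u t = u c + ∫ x in c..t, g x

namespace IsPrimitiveOn

variable {u g : ℝ → F} {c d : ℝ}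

theorem integrable_of_mem (h : IsPrimitiveOn u g c d) {s t : ℝ} (hs : s ∈ Icc c d)
    (ht : t ∈ Icc c d) : IntervalIntegrable g volume s t :=
  h.integrable.mono_set (by
    rw [uIcc_of_le h.le]; exact uIcc_subset_Icc hs ht)

theorem sub_eq (h : IsPrimitiveOn u g c d) {s t : ℝ} (hs : s ∈ Icc c d) (ht : t ∈ Icc c d) :
    u t - u s = ∫ x in s..t, g x := by
  have hc : c ∈ Icc c d := left_mem_Icc.2 h.le
  rw [h.eq t ht, h.eq s hs, ← intervalIntegral.integral_interval_sub_left
    (h.integrable_of_mem hc ht) (h.integrable_of_mem hc hs)]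
  abel

theorem mono (h : IsPrimitiveOn u g c d) {c' d' : ℝ} (hc : c ≤ c') (hcd : c' ≤ d')
    (hd : d' ≤ d) : IsPrimitiveOn u g c' d' where
  le := hcd
  integrable := h.integrable_of_mem ⟨hc, hcd.trans hd⟩ ⟨hc.trans hcd, hd⟩
  eq t ht := by
    rw [← h.sub_eq ⟨hc, hcd.trans hd⟩ ⟨hc.trans ht.1, ht.2.trans hd⟩]; abel

theorem absolutelyContinuous (h : IsPrimitiveOn u g c d) :
    AbsolutelyContinuousOnInterval u c d := by
  have hn := h.integrable.norm.absolutelyContinuousOnInterval_intervalIntegral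
    (c := c) (by simp)
  rw [absolutelyContinuousOnInterval_iff] at hn ⊢
  intro ε hε
  obtain ⟨δ, hδ, H⟩ := hn ε hε
  refine ⟨δ, hδ, fun J hJ hJδ => lt_of_le_of_lt (Finset.sum_le_sum fun i hi => ?_) (H J hJ hJδ)⟩
  have h1 := (hJ.1 i hi)
  rw [uIcc_of_le h.le] at h1
  have hc : c ∈ Icc c d := left_mem_Icc.2 h.le
  rw [dist_eq_norm, dist_eq_norm, h.sub_eq h1.2 h1.1,
    intervalIntegral.integral_interval_sub_left (h.integrable_of_mem hc h1.1).norm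
      (h.integrable_of_mem hc h1.2).norm, Real.norm_eq_abs]
  exact intervalIntegral.norm_integral_le_abs_integral_norm

theorem continuousOn (h : IsPrimitiveOn u g c d) : ContinuousOn u (Icc c d) := by
  have := h.absolutelyContinuous.continuousOn
  rwa [uIcc_of_le h.le] at this

theorem ae_hasDerivAt [CompleteSpace F] (h : IsPrimitiveOn u g c d) :
    ∀ᵐ t, t ∈ Ioo c d → HasDerivAt u (g t) t := by
  filter_upwards [h.integrable.ae_hasDerivAt_integral] with t ht htI
  have h1 := ht (by rw [uIcc_of_le h.le]; exact Ioo_subset_Icc_self htI) c (by simp)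
  refine (h1.const_add (u c)).congr_of_eventuallyEq ?_
  filter_upwards [Ioo_mem_nhds htI.1 htI.2] with s hs
  exact h.eq s (Ioo_subset_Icc_self hs)

/-- The difference of `u` and the primitive of `g` is absolutely continuous with derivative zero
almost everywhere, hence constant. Product and chain rules thereby reduce to pointwise
differentiation almost everywhere. -/
theorem of_absolutelyContinuous [CompleteSpace F] (hcd : c ≤ d)
    (hu : AbsolutelyContinuousOnInterval u c d) (hg : IntervalIntegrable g volume c d)
    (hd : ∀ᵐ t, t ∈ Ioo c d → HasDerivAt u (g t) t) : IsPrimitiveOn u g c d where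
  le := hcd
  integrable := hg
  eq := by
    have hp : IsPrimitiveOn (fun t => ∫ x in c..t, g x) g c d := ⟨hcd, hg, fun t _ => by simp⟩
    have hz := hu.sub hp.absolutelyContinuous
    obtain ⟨C, hC⟩ := hz.const_of_ae_hasDerivAt_zero (by
      have h₁ : ∀ᵐ x : ℝ, x ≠ c := by simp [ae_iff, measure_singleton]
      have h₂ : ∀ᵐ x : ℝ, x ≠ d := by simp [ae_iff, measure_singleton]
      filter_upwards [hd, hp.ae_hasDerivAt, h₁, h₂] with t h1 h2 h3 h4 ht
      rw [uIcc_of_le hcd] at ht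
      have htI : t ∈ Ioo c d := ⟨lt_of_le_of_ne ht.1 h3.symm, lt_of_le_of_ne ht.2 h4⟩
      simpa using (h1 htI).sub (h2 htI))
    rw [uIcc_of_le hcd] at hC
    intro t ht
    have e1 := hC t ht
    have e2 := hC c (left_mem_Icc.2 hcd)
    simp only [Pi.sub_apply, intervalIntegral.integral_same, sub_zero] at e1 e2
    rw [e2, ← e1]; abel

theorem ae_eq_deriv [CompleteSpace F] {v h : ℝ → F} (hu : IsPrimitiveOn u g c d)
    (hv : IsPrimitiveOn v h c d) (huv : EqOn u v (Icc c d)) :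
    ∀ᵐ t, t ∈ Ioo c d → g t = h t := by
  filter_upwards [hu.ae_hasDerivAt, hv.ae_hasDerivAt] with t h1 h2 ht
  refine (h1 ht).unique ((h2 ht).congr_of_eventuallyEq ?_)
  filter_upwards [Ioo_mem_nhds ht.1 ht.2] with s hs using huv (Ioo_subset_Icc_self hs)

theorem congr_deriv (hu : IsPrimitiveOn u g c d) {h : ℝ → F}
    (hgh : ∀ᵐ t, t ∈ Ioo c d → g t = h t) : IsPrimitiveOn u h c d := by
  have key : ∀ᵐ t, t ∈ Ioc c d → g t = h t := by
    have h₂ : ∀ᵐ x : ℝ, x ≠ d := by simp [ae_iff, measure_singleton]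
    filter_upwards [hgh, h₂] with t h1 h2 h3
    exact h1 ⟨h3.1, lt_of_le_of_ne h3.2 h2⟩
  refine ⟨hu.le, hu.integrable.congr_ae ?_, fun t ht => ?_⟩
  · rw [uIoc_of_le hu.le]
    exact (ae_restrict_iff' measurableSet_Ioc).2 key
  · rw [hu.eq t ht]
    congr 1
    refine intervalIntegral.integral_congr_ae ?_
    filter_upwards [key] with x hx hxt
    rw [uIoc_of_le ht.1] at hxt
    exact hx ⟨hxt.1, hxt.2.trans ht.2⟩

theorem smul [CompleteSpace F] (hu : IsPrimitiveOn u g c d) {φ : ℝ → ℝ} (hφ : ContDiff ℝ 1 φ) :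
    IsPrimitiveOn (fun t => φ t • u t) (fun t => deriv φ t • u t + φ t • g t) c d := by
  refine of_absolutelyContinuous hu.le
    (hφ.contDiffOn.absolutelyContinuousOnInterval.smul hu.absolutelyContinuous) ?_ ?_
  · refine IntervalIntegrable.add (ContinuousOn.intervalIntegrable ?_)
      (hu.integrable.continuousOn_smul hφ.continuous.continuousOn)
    rw [uIcc_of_le hu.le]
    exact (hφ.continuous_deriv le_rfl).continuousOn.smul hu.continuousOn
  · filter_upwards [hu.ae_hasDerivAt] with t h1 ht
    have := ((hφ.differentiable (by simp) t).hasDerivAt).smul (h1 ht)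
    rwa [add_comm] at this

theorem add_smul (hu : IsPrimitiveOn u g c d) {v h : ℝ → F} (hv : IsPrimitiveOn v h c d) (r : ℝ) :
    IsPrimitiveOn (fun t => u t + r • v t) (fun t => g t + r • h t) c d where
  le := hu.le
  integrable := hu.integrable.add (hv.integrable.smul r)
  eq t ht := by
    have hc : c ∈ Icc c d := left_mem_Icc.2 hu.le
    rw [intervalIntegral.integral_add (g := fun t => r • h t) (hu.integrable_of_mem hc ht)
      ((hv.integrable_of_mem hc ht).smul r), intervalIntegral.integral_smul, hu.eq t ht, hv.eq t ht,
      smul_add]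
    abel

/-- Chain rule for the composition of a primitive with a `C¹` map. -/
theorem comp [CompleteSpace F] {G : Type*} [NormedAddCommGroup G] [NormedSpace ℝ G]
    [CompleteSpace G] (hu : IsPrimitiveOn u g c d) {Φ : F → G}
    (hΦ : ∀ t ∈ Icc c d, ContDiffAt ℝ 1 Φ (u t)) :
    IsPrimitiveOn (fun t => Φ (u t)) (fun t => fderiv ℝ Φ (u t) (g t)) c d := by
  have hK : IsCompact (u '' Icc c d) := isCompact_Icc.image_of_continuousOn hu.continuousOn
  -- A `C¹` map is Lipschitz on the compact image of the curve, and this preserves absolute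
  -- continuity.
  obtain ⟨K, hL⟩ := LocallyLipschitzOn.exists_lipschitzOnWith_of_compact (f := Φ) hK (by
    rintro _ ⟨t, ht, rfl⟩
    obtain ⟨K, s, hs, hL⟩ := (hΦ t ht).exists_lipschitzOnWith
    exact ⟨K, s, mem_nhdsWithin_of_mem_nhds hs, hL⟩)
  refine of_absolutelyContinuous hu.le ?_ ?_ ?_
  · have hu' := hu.absolutelyContinuous
    rw [absolutelyContinuousOnInterval_iff] at hu' ⊢
    intro ε hε
    obtain ⟨δ, hδ, H⟩ := hu' (ε / (K + 1)) (by positivity)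
    refine ⟨δ, hδ, fun J hJ hJδ => ?_⟩
    have h1 := H J hJ hJδ
    have h2 : ∑ i ∈ Finset.range J.1, dist (Φ (u (J.2 i).1)) (Φ (u (J.2 i).2)) ≤
        K * ∑ i ∈ Finset.range J.1, dist (u (J.2 i).1) (u (J.2 i).2) := by
      rw [Finset.mul_sum]
      refine Finset.sum_le_sum fun i hi => ?_
      have h3 := hJ.1 i hi
      rw [uIcc_of_le hu.le] at h3
      exact hL.dist_le_mul _ (mem_image_of_mem _ h3.1) _ (mem_image_of_mem _ h3.2)
    have h4 : (0:ℝ) ≤ ∑ i ∈ Finset.range J.1, dist (u (J.2 i).1) (u (J.2 i).2) :=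
      Finset.sum_nonneg fun _ _ => dist_nonneg
    calc _ ≤ _ := h2
      _ ≤ (K + 1) * ∑ i ∈ Finset.range J.1, dist (u (J.2 i).1) (u (J.2 i).2) := by
          gcongr; simp
      _ < (K + 1) * (ε / (K + 1)) := by gcongr
      _ = ε := by field_simp
  · have hcont : ContinuousOn (fun t => fderiv ℝ Φ (u t)) (Icc c d) := fun t ht =>
      ((hΦ t ht).continuousAt_fderiv (by simp)).comp_continuousWithinAt (hu.continuousOn t ht)
    obtain ⟨C, hC⟩ := isCompact_Icc.exists_bound_of_continuousOn hcont
    have h1 := hu.integrable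
    rw [intervalIntegrable_iff, uIoc_of_le hu.le] at *
    have hm : AEStronglyMeasurable (fun t => fderiv ℝ Φ (u t)) (volume.restrict (Ioc c d)) :=
      (hcont.mono Ioc_subset_Icc_self).aestronglyMeasurable measurableSet_Ioc
    refine Integrable.mono' (h1.norm.const_mul C) ?_ ?_
    · exact (ContinuousLinearMap.apply ℝ G).flip.aestronglyMeasurable_comp₂ hm
        h1.aestronglyMeasurable
    · filter_upwards [ae_restrict_mem measurableSet_Ioc] with t ht
      exact (ContinuousLinearMap.le_opNorm _ _).trans
        (mul_le_mul_of_nonneg_right (hC t (Ioc_subset_Icc_self ht)) (norm_nonneg _))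
  · filter_upwards [hu.ae_hasDerivAt] with t h1 ht
    exact (((hΦ t (Ioo_subset_Icc_self ht)).differentiableAt (by simp)).hasFDerivAt).comp_hasDerivAt
      t (h1 ht)

/-- Integration by parts against a `C¹` function vanishing at the endpoints. -/
theorem integral_deriv_smul [CompleteSpace F] (hu : IsPrimitiveOn u g c d) {φ : ℝ → ℝ}
    (hφ : ContDiff ℝ 1 φ) (hc : φ c = 0) (hd : φ d = 0) :
    ∫ t in c..d, deriv φ t • u t = -∫ t in c..d, φ t • g t := by
  have hφ' : ContinuousOn (deriv φ) (Icc c d) := (hφ.continuous_deriv le_rfl).continuousOn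
  have i1 : IntervalIntegrable (fun t => deriv φ t • u t) volume c d := by
    refine ContinuousOn.intervalIntegrable ?_
    rw [uIcc_of_le hu.le]
    exact hφ'.smul hu.continuousOn
  have i2 : IntervalIntegrable (fun t => φ t • g t) volume c d :=
    hu.integrable.continuousOn_smul hφ.continuous.continuousOn
  have hp := hu.smul hφ
  have h := hp.sub_eq (left_mem_Icc.2 hu.le) (right_mem_Icc.2 hu.le)
  rw [intervalIntegral.integral_add i1 i2] at h
  simp only [hc, hd, zero_smul, sub_zero] at h
  exact eq_neg_of_add_eq_zero_left h.symm

end IsPrimitiveOn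

/-- A smooth function with compact support in `(c, d)` and vanishing integral is the derivative of
another such function. -/
theorem exists_test_primitive {c d : ℝ} (hcd : c < d) {ψ : ℝ → ℝ} (hψ : ContDiff ℝ ∞ ψ)
    (hs : tsupport ψ ⊆ Ioo c d) (h0 : ∫ t in c..d, ψ t = 0) :
    ∃ φ : ℝ → ℝ, ContDiff ℝ ∞ φ ∧ tsupport φ ⊆ Ioo c d ∧ deriv φ = ψ := by
  have hK : IsCompact (tsupport ψ) :=
    isCompact_Icc.of_isClosed_subset (isClosed_tsupport ψ) (hs.trans Ioo_subset_Icc_self)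
  -- The primitive from `c` vanishes before `c'` trivially, and after `d'` because the total
  -- integral is zero.
  obtain ⟨c', d', hc', hd', hcd', hsub⟩ : ∃ c' d', c < c' ∧ d' < d ∧ c' ≤ d' ∧
      tsupport ψ ⊆ Icc c' d' := by
    rcases (tsupport ψ).eq_empty_or_nonempty with he | hne
    · exact ⟨(c + d) / 2, (c + d) / 2, by linarith, by linarith, le_rfl, by simp [he]⟩
    · obtain ⟨x, hx⟩ := hK.exists_isLeast hne
      obtain ⟨y, hy⟩ := hK.exists_isGreatest hne
      exact ⟨x, y, (hs hx.1).1, (hs hy.1).2, hx.2 hy.1, fun t ht => ⟨hx.2 ht, hy.2 ht⟩⟩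
  have hz : ∀ t, t ∉ Icc c' d' → ψ t = 0 := fun t ht =>
    image_eq_zero_of_notMem_tsupport fun h => ht (hsub h)
  have hI : ∀ s t, IntervalIntegrable ψ volume s t := fun s t =>
    hψ.continuous.intervalIntegrable s t
  have hder : ∀ t, HasDerivAt (fun t => ∫ x in c..t, ψ x) (ψ t) t := fun t =>
    intervalIntegral.integral_hasDerivAt_right (hI _ _)
      (hψ.continuous.stronglyMeasurableAtFilter _ _) hψ.continuous.continuousAt
  have hderiv : deriv (fun t => ∫ x in c..t, ψ x) = ψ := funext fun t => (hder t).deriv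
  refine ⟨fun t => ∫ x in c..t, ψ x, ?_, ?_, hderiv⟩
  · rw [show (∞ : WithTop ℕ∞) = ∞ + 1 from rfl, contDiff_succ_iff_deriv]
    refine ⟨fun t => (hder t).differentiableAt, by simp, by rwa [hderiv]⟩
  · refine (closure_minimal ?_ isClosed_Icc).trans (Icc_subset_Ioo hc' hd')
    intro t ht
    by_contra hn
    refine ht ?_
    simp only [mem_Icc, not_and_or, not_le] at hn
    rcases hn with hn | hn
    · refine (intervalIntegral.integral_congr (g := fun _ => 0) fun x hx => ?_).trans (by simp)
      refine hz x fun hx' => ?_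
      have := hx.2
      rcases le_max_iff.1 this with h | h <;> linarith [hx'.1]
    · have e : ∫ x in c..t, ψ x = (∫ x in c..d, ψ x) + ∫ x in d..t, ψ x :=
        (intervalIntegral.integral_add_adjacent_intervals (hI _ _) (hI _ _)).symm
      simp only [e, h0, zero_add]
      refine (intervalIntegral.integral_congr (g := fun _ => 0) fun x hx => ?_).trans (by simp)
      refine hz x fun hx' => ?_
      have := hx.1
      rcases min_le_iff.1 this with h | h <;> linarith [hx'.2]

theorem exists_test_integral_eq_one {c d : ℝ} (hcd : c < d) :
    ∃ θ : ℝ → ℝ, ContDiff ℝ ∞ θ ∧ tsupport θ ⊆ Ioo c d ∧ ∫ t in c..d, θ t = 1 := by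
  let f : ContDiffBump ((c + d) / 2) := ⟨(d - c) / 8, (d - c) / 4, by linarith, by linarith⟩
  have hsub : tsupport f ⊆ Ioo c d := by
    rw [f.tsupport_eq, Real.closedBall_eq_Icc]
    exact Icc_subset_Ioo (by simp only [f]; linarith) (by simp only [f]; linarith)
  refine ⟨f.normed volume, f.contDiff_normed, ?_, ?_⟩
  · rwa [f.tsupport_normed_eq, ← f.tsupport_eq]
  · rw [intervalIntegral.integral_of_le hcd.le, setIntegral_eq_integral_of_forall_compl_eq_zero,
      f.integral_normed]
    intro x hx
    refine image_eq_zero_of_notMem_tsupport fun h => hx ?_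
    rw [f.tsupport_normed_eq, ← f.tsupport_eq] at h
    exact Ioo_subset_Ioc_self (hsub h)

/-- du Bois-Reymond lemma: an integrable function whose weak derivative on `(c, d)` is an
integrable function `h` is almost everywhere equal to a primitive of `h`. -/
theorem exists_primitive_of_weakDeriv [CompleteSpace F] {c d : ℝ} (hcd : c < d) {w h : ℝ → F}
    (hw : IntervalIntegrable w volume c d) (hh : IntervalIntegrable h volume c d)
    (hweak : ∀ φ : ℝ → ℝ, ContDiff ℝ ∞ φ → tsupport φ ⊆ Ioo c d →
      ∫ t in c..d, deriv φ t • w t = -∫ t in c..d, φ t • h t) :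
    ∃ W : ℝ → F, IsPrimitiveOn W h c d ∧ ∀ᵐ t, t ∈ Ioo c d → w t = W t := by
  have hp : IsPrimitiveOn (fun t => ∫ x in c..t, h x) h c d := ⟨hcd.le, hh, fun t _ => by simp⟩
  have hpi : IntervalIntegrable (fun t => ∫ x in c..t, h x) volume c d := by
    refine ContinuousOn.intervalIntegrable ?_
    rw [uIcc_of_le hcd.le]; exact hp.continuousOn
  set z : ℝ → F := fun t => w t - ∫ x in c..t, h x with hz
  have hzi : IntervalIntegrable z volume c d := hw.sub hpi
  have smul_int : ∀ {φ : ℝ → ℝ}, ContDiff ℝ ∞ φ → ∀ {f : ℝ → F},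
      IntervalIntegrable f volume c d → IntervalIntegrable (fun t => φ t • f t) volume c d :=
    fun hφ _ hf => hf.continuousOn_smul hφ.continuous.continuousOn
  have hout : ∀ {φ : ℝ → ℝ}, tsupport φ ⊆ Ioo c d → ∀ t, t ∉ Ioo c d → φ t = 0 := fun hφ t ht =>
    image_eq_zero_of_notMem_tsupport fun h' => ht (hφ h')
  have hzero : ∀ φ : ℝ → ℝ, ContDiff ℝ ∞ φ → tsupport φ ⊆ Ioo c d →
      ∫ t in c..d, deriv φ t • z t = 0 := by
    intro φ h1 h2
    have hd : ContDiff ℝ ∞ (deriv φ) := by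
      rw [show (∞ : WithTop ℕ∞) = ∞ + 1 from rfl, contDiff_succ_iff_deriv] at h1
      exact h1.2.2
    have e := hp.integral_deriv_smul (h1.of_le (by simp)) (hout h2 c (by simp))
      (hout h2 d (by simp))
    simp only [hz, smul_sub]
    rw [intervalIntegral.integral_sub (smul_int hd hw) (smul_int hd hpi), hweak φ h1 h2, e,
      sub_self]
  obtain ⟨θ, hθ, hθs, hθ1⟩ := exists_test_integral_eq_one hcd
  -- For every test function `ψ`, subtracting `(∫ ψ) θ` leaves a test function of integral zero,
  -- that is, the derivative of a test function, against which `z` integrates to zero. Hence `∫ ψ z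
  -- = (∫ ψ) C`, so `z` is almost everywhere the constant `C`.
  set C : F := ∫ t in c..d, θ t • z t with hC
  have hae := isOpen_Ioo.ae_eq_zero_of_integral_contDiff_smul_eq_zero (U := Ioo c d)
    (f := fun t => z t - C) (μ := volume) (by
      have h3 : IntervalIntegrable (fun t => z t - C) volume c d :=
        hzi.sub intervalIntegrable_const
      rw [intervalIntegrable_iff, uIoc_of_le hcd.le] at h3
      exact (IntegrableOn.mono_set h3 Ioo_subset_Ioc_self).locallyIntegrableOn) (by
      intro ψ h1 _ h3
      set r : ℝ := ∫ t in c..d, ψ t with hr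
      have hψθ : ContDiff ℝ ∞ (fun t => ψ t - r * θ t) := h1.sub (contDiff_const.mul hθ)
      have hsupp : tsupport (fun t => ψ t - r * θ t) ⊆ Ioo c d := by
        have hsub : tsupport (fun t => ψ t - r * θ t) ⊆ tsupport ψ ∪ tsupport θ := by
          refine closure_minimal (fun t ht => ?_)
            ((isClosed_tsupport ψ).union (isClosed_tsupport θ))
          by_contra hn
          rw [mem_union, not_or] at hn
          exact ht (by simp [image_eq_zero_of_notMem_tsupport hn.1,
            image_eq_zero_of_notMem_tsupport hn.2])
        exact hsub.trans (union_subset h3 hθs)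
      obtain ⟨φ, p1, p2, p3⟩ := exists_test_primitive hcd hψθ hsupp (by
        rw [intervalIntegral.integral_sub (f := ψ) (g := fun t => r * θ t)
          (h1.continuous.intervalIntegrable _ _)
          ((continuous_const.mul hθ.continuous).intervalIntegrable _ _),
          intervalIntegral.integral_const_mul, hθ1, mul_one, sub_self])
      have e := hzero φ p1 p2
      rw [p3] at e
      simp only [sub_smul, mul_smul] at e
      rw [intervalIntegral.integral_sub (g := fun t => r • θ t • z t)
        (smul_int h1 hzi) ((smul_int hθ hzi).smul r),
        intervalIntegral.integral_smul, ← hC] at e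
      have e2 : ∫ t in c..d, ψ t • (z t - C) = 0 := by
        simp only [smul_sub]
        rw [intervalIntegral.integral_sub (smul_int h1 hzi) (smul_int h1 intervalIntegrable_const),
          intervalIntegral.integral_smul_const, ← hr]
        exact e
      rw [← setIntegral_eq_integral_of_forall_compl_eq_zero (s := Ioc c d),
        ← intervalIntegral.integral_of_le hcd.le, e2]
      intro x hx
      rw [hout h3 x (fun h => hx (Ioo_subset_Ioc_self h)), zero_smul])
  refine ⟨fun t => C + ∫ x in c..t, h x, ⟨hcd.le, hh, fun t _ => by simp⟩, ?_⟩
  filter_upwards [hae] with t ht htI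
  have := ht htI
  simp only [hz] at this
  rw [sub_eq_zero] at this
  rw [← this]; abel

end Primitive

/-! ### Translation between `H1` on the unit interval and curves on the real line. -/

section Curves

variable {E : Type*} [NormedAddCommGroup E] [InnerProductSpace ℝ E]

/-- `u` is an `H¹` curve on `[0, 1]` with derivative `g`, going from `p` to `q` outside `O`. -/
structure IsCurve (O : Set E) (p q : E) (u g : ℝ → E) : Prop where
  prim : IsPrimitiveOn u g 0 1
  memLp : MemLp g 2 (volume.restrict (Icc 0 1))
  zero : u 0 = p
  one : u 1 = q
  notMem : ∀ t ∈ Icc (0 : ℝ) 1, u t ∉ O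

/-- The curve `u` with derivative `g` minimizes the energy among the curves from `p` to `q`. -/
structure IsMinCurve (O : Set E) (p q : E) (u g : ℝ → E) : Prop extends IsCurve O p q u g where
  le : ∀ v h, IsCurve O p q v h → ∫ t in (0 : ℝ)..1, ‖g t‖ ^ 2 ≤ ∫ t in (0 : ℝ)..1, ‖h t‖ ^ 2

theorem integral_unitInterval {F : Type*} [NormedAddCommGroup F] [NormedSpace ℝ F] (f : ℝ → F) :
    ∫ t : I, f t = ∫ x in (0 : ℝ)..1, f x := by
  rw [intervalIntegral.integral_of_le zero_le_one, ← integral_Icc_eq_integral_Ioc,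
    ← map_comap_subtype_coe measurableSet_Icc volume,
    (MeasurableEmbedding.subtype_coe measurableSet_Icc).integral_map]
  rfl

theorem memLp_unitInterval_iff {F : Type*} [NormedAddCommGroup F] {f : ℝ → F} :
    MemLp (fun t : I => f t) 2 volume ↔ MemLp f 2 (volume.restrict (Icc 0 1)) := by
  rw [← map_comap_subtype_coe measurableSet_Icc volume,
    (MeasurableEmbedding.subtype_coe measurableSet_Icc).memLp_map_measure_iff]
  rfl

/-- The extension to the real line of the continuous representative. -/
def H1.path (u : H1 E) (t : ℝ) : E := u (projIcc 0 1 zero_le_one t)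

/-- The extension to the real line of the weak derivative. -/
def H1.dpath (u : H1 E) (t : ℝ) : E := u.weakDeriv (projIcc 0 1 zero_le_one t)

theorem H1.path_coe (u : H1 E) (t : I) : u.path t = u t := by simp [H1.path]

theorem H1.path_of_mem (u : H1 E) {t : ℝ} (ht : t ∈ Icc (0 : ℝ) 1) : u.path t = u ⟨t, ht⟩ :=
  u.path_coe ⟨t, ht⟩

theorem H1.dpath_coe (u : H1 E) (t : I) : u.dpath t = u.weakDeriv t := by simp [H1.dpath]

theorem H1.continuous_path (u : H1 E) : Continuous u.path :=
  u.toFun.continuous.comp continuous_projIcc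

theorem H1.memLp_dpath (u : H1 E) : MemLp u.dpath 2 (volume.restrict (Icc 0 1)) := by
  rw [← memLp_unitInterval_iff]
  simpa only [H1.dpath_coe] using Lp.memLp u.weakDeriv

theorem intervalIntegrable_of_memLp {F : Type*} [NormedAddCommGroup F] {g : ℝ → F}
    (h : MemLp g 2 (volume.restrict (Icc (0 : ℝ) 1))) : IntervalIntegrable g volume 0 1 := by
  rw [intervalIntegrable_iff, uIoc_of_le zero_le_one]
  exact IntegrableOn.mono_set (h.integrable (by norm_num)) Ioc_subset_Icc_self

theorem H1.energy_eq (u : H1 E) : energy u = ∫ t in (0 : ℝ)..1, ‖u.dpath t‖ ^ 2 := by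
  rw [← integral_unitInterval]
  simp only [H1.dpath_coe]
  rfl

theorem H1.isPrimitiveOn [CompleteSpace E] (u : H1 E) : IsPrimitiveOn u.path u.dpath 0 1 := by
  have hi := intervalIntegrable_of_memLp u.memLp_dpath
  obtain ⟨W, hW, hae⟩ := exists_primitive_of_weakDeriv zero_lt_one
    (u.continuous_path.intervalIntegrable 0 1) hi (fun φ h1 h2 => by
      rw [← integral_unitInterval, ← integral_unitInterval]
      simpa only [H1.dpath_coe, H1.path_coe] using u.isWeakDeriv φ h1 h2)
  have heq : EqOn u.path W (Icc 0 1) := by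
    have h1 : EqOn u.path W (Ioo 0 1) := by
      refine Measure.eqOn_open_of_ae_eq (μ := volume) ?_ isOpen_Ioo u.continuous_path.continuousOn
        (hW.continuousOn.mono Ioo_subset_Icc_self)
      exact (ae_restrict_iff' measurableSet_Ioo).2 hae
    rw [← closure_Ioo (zero_ne_one' ℝ)]
    refine h1.of_subset_closure u.continuous_path.continuousOn ?_ Ioo_subset_Icc_self
      (by rw [closure_Ioo (zero_ne_one' ℝ)]) |>.mono (by rw [closure_Ioo (zero_ne_one' ℝ)])
    exact hW.continuousOn
  refine ⟨zero_le_one, hi, fun t ht => ?_⟩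
  rw [heq ht, heq (left_mem_Icc.2 zero_le_one)]
  exact hW.eq t ht

theorem exists_H1 [CompleteSpace E] {u g : ℝ → E} (h : IsPrimitiveOn u g 0 1)
    (hg : MemLp g 2 (volume.restrict (Icc 0 1))) :
    ∃ U : H1 E, (∀ t : I, U t = u t) ∧ energy U = ∫ t in (0 : ℝ)..1, ‖g t‖ ^ 2 := by
  have hm : MemLp (fun t : I => g t) 2 volume := memLp_unitInterval_iff.2 hg
  have hae := hm.coeFn_toLp
  refine ⟨⟨⟨fun t : I => u t, continuousOn_iff_continuous_domRestrict.1 h.continuousOn⟩,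
    hm.toLp _, fun φ h1 h2 => ?_⟩, fun t => rfl, ?_⟩
  · have hout : ∀ t, t ∉ Ioo (0 : ℝ) 1 → φ t = 0 := fun t ht =>
      image_eq_zero_of_notMem_tsupport fun h' => ht (h2 h')
    have e := h.integral_deriv_smul (h1.of_le (by simp)) (hout 0 (by simp)) (hout 1 (by simp))
    rw [← integral_unitInterval, ← integral_unitInterval] at e
    refine e.trans ?_
    rw [neg_inj]
    refine integral_congr_ae ?_
    filter_upwards [hae] with t ht
    rw [ht]
  · rw [← integral_unitInterval]
    refine integral_congr_ae ?_
    filter_upwards [hae] with t ht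
    simp only [ht]

variable {O : Set E} {p q : E}

theorem H1.isCurve_iff [CompleteSpace E] (u : H1 E) :
    IsCurve O p q u.path u.dpath ↔ u ∈ admissible O p q := by
  constructor
  · intro h
    refine ⟨?_, ?_, fun t => ?_⟩
    · rw [← h.zero, u.path_of_mem (by simp)]; rfl
    · rw [← h.one, u.path_of_mem (by simp)]; rfl
    · rw [← u.path_coe]; exact h.notMem t t.2
  · rintro ⟨h0, h1, h2⟩
    refine ⟨u.isPrimitiveOn, u.memLp_dpath, ?_, ?_, fun t ht => ?_⟩
    · rw [← h0, u.path_of_mem (by simp)]; rfl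
    · rw [← h1, u.path_of_mem (by simp)]; rfl
    · rw [u.path_of_mem ht]; exact h2 _

theorem IsCurve.exists_H1 [CompleteSpace E] {u g : ℝ → E} (h : IsCurve O p q u g) :
    ∃ U ∈ admissible O p q, (∀ t : I, U t = u t) ∧
      energy U = ∫ t in (0 : ℝ)..1, ‖g t‖ ^ 2 := by
  obtain ⟨U, h1, h2⟩ := Obstacle.exists_H1 h.prim h.memLp
  refine ⟨U, ⟨?_, ?_, fun t => ?_⟩, h1, h2⟩
  · rw [h1]; exact h.zero
  · rw [h1]; exact h.one
  · rw [h1]; exact h.notMem t t.2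

theorem H1.isMinCurve_iff [CompleteSpace E] (u : H1 E) :
    IsMinCurve O p q u.path u.dpath ↔ IsMinimizer O p q u := by
  constructor
  · intro h
    refine ⟨u.isCurve_iff.1 h.toIsCurve, fun v hv => ?_⟩
    rw [u.energy_eq, v.energy_eq]
    exact h.le _ _ (v.isCurve_iff.2 hv)
  · rintro ⟨h1, h2⟩
    refine ⟨u.isCurve_iff.2 h1, fun v h hv => ?_⟩
    obtain ⟨V, hV, -, he⟩ := hv.exists_H1
    rw [← he, ← u.energy_eq]
    exact h2 V hV

theorem IsMinCurve.exists_H1 [CompleteSpace E] {u g : ℝ → E} (h : IsMinCurve O p q u g) :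
    ∃ U, IsMinimizer O p q U ∧ ∀ t : I, U t = u t := by
  obtain ⟨U, h1, h2, h3⟩ := h.toIsCurve.exists_H1
  refine ⟨U, ⟨h1, fun v hv => ?_⟩, h2⟩
  rw [h3, v.energy_eq]
  exact h.le _ _ (v.isCurve_iff.2 hv)

theorem H1.ext_path [CompleteSpace E] {u v : H1 E} (h : EqOn u.path v.path (Icc 0 1)) : u = v := by
  refine H1.ext_toFun (ContinuousMap.ext fun t => ?_)
  have := h t.2
  rwa [u.path_coe, v.path_coe] at this

end Curves

/-! ### Smoothness of the gauge and the field of supporting normals. -/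

section Support

theorem eq_zero_of_mem_frontier {E : Type*} [TopologicalSpace E] {K U : Set E} {y : E} {ρ : E → ℝ} (hU : U ∈ 𝓝 y)
    (hρ : ContinuousAt ρ y) (hy : y ∈ frontier K) (hK : IsOpen K)
    (hρK : ∀ z ∈ U, z ∈ K ↔ ρ z < 0) : ρ y = 0 := by
  have hyU : y ∈ U := mem_of_mem_nhds hU
  rw [hK.frontier_eq] at hy
  refine le_antisymm ?_ (not_lt.1 fun h => hy.2 ((hρK y hyU).2 h))
  have : (𝓝[K] y).NeBot := mem_closure_iff_nhdsWithin_neBot.1 hy.1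
  refine le_of_tendsto (hρ.tendsto.mono_left (nhdsWithin_le_nhds (s := K))) ?_
  filter_upwards [self_mem_nhdsWithin, nhdsWithin_le_nhds hU] with z h1 h2
  exact ((hρK z h2).1 h1).le

variable {E : Type*} [NormedAddCommGroup E] [InnerProductSpace ℝ E]

/-- The differential of a defining function does not vanish in the direction of an interior point
of a convex set. -/
theorem fderiv_pos_of_convex {K U : Set E} (hc : Convex ℝ K) (h0 : K ∈ 𝓝 0) {y : E} {ρ : E → ℝ}
    (hU : U ∈ 𝓝 y) (hρ : DifferentiableAt ℝ ρ y) (hne : fderiv ℝ ρ y ≠ 0)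
    (hy : y ∈ frontier K) (hK : IsOpen K) (hρK : ∀ z ∈ U, z ∈ K ↔ ρ z < 0) :
    0 < fderiv ℝ ρ y y := by
  have hycl : y ∈ closure K := frontier_subset_closure hy
  have hρ0 : ρ y = 0 := eq_zero_of_mem_frontier hU hρ.continuousAt hy hK hρK
  obtain ⟨r, hr, hball⟩ := Metric.mem_nhds_iff.1 h0
  -- The points `y + t (w - y)` with small `t > 0` lie in `K`, where `ρ < 0 = ρ y`, so `ρ` has
  -- nonpositive derivative at `y` along `w - y`. If the derivative along `y` were nonpositive too,
  -- the differential would be nonpositive on a ball, hence zero.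
  have key : ∀ w ∈ Metric.ball (0 : E) r, fderiv ℝ ρ y w ≤ fderiv ℝ ρ y y := by
    intro w hw
    rw [← sub_nonpos, ← map_sub]
    have hline : HasDerivAt (fun t : ℝ => ρ (y + t • (w - y))) (fderiv ℝ ρ y (w - y)) 0 := by
      have h1 : HasDerivAt (fun t : ℝ => y + t • (w - y)) (w - y) 0 := by
        simpa using ((hasDerivAt_id (0 : ℝ)).smul_const (w - y)).const_add y
      have h2 : HasFDerivAt ρ (fderiv ℝ ρ y) (y + (0 : ℝ) • (w - y)) := by
        simpa using hρ.hasFDerivAt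
      exact h2.comp_hasDerivAt (0 : ℝ) h1
    have hs := hline.hasDerivWithinAt (s := Ioi 0)
    rw [hasDerivWithinAt_iff_tendsto_slope' (by simp)] at hs
    refine le_of_tendsto hs ?_
    have hcont : Tendsto (fun t : ℝ => y + t • (w - y)) (𝓝 0) (𝓝 y) := by
      have : Continuous (fun t : ℝ => y + t • (w - y)) := by fun_prop
      simpa using this.tendsto 0
    filter_upwards [self_mem_nhdsWithin, nhdsWithin_le_nhds (hcont hU),
      nhdsWithin_le_nhds (Iic_mem_nhds zero_lt_one)] with t ht htU ht1
    have hmem : y + t • (w - y) ∈ K := by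
      have hwi : w ∈ interior K := by rw [hK.interior_eq]; exact hball hw
      have h3 := hc.combo_interior_closure_mem_interior hwi hycl (a := t) (b := 1 - t) ht
        (by simpa using ht1) (by ring)
      rw [hK.interior_eq] at h3
      convert h3 using 1
      module
    have h4 := (hρK _ htU).1 hmem
    have ht' : (0 : ℝ) < t := ht
    simp only [slope_def_field, zero_smul, add_zero, hρ0, sub_zero]
    exact (div_neg_of_neg_of_pos h4 ht').le
  by_contra hcon
  rw [not_lt] at hcon
  refine hne (ContinuousLinearMap.ext fun v => ?_)
  have hle : ∀ v, fderiv ℝ ρ y v ≤ 0 := by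
    intro v
    obtain ⟨ε, hε, hεv⟩ : ∃ ε : ℝ, 0 < ε ∧ ε • v ∈ Metric.ball (0 : E) r := by
      refine ⟨r / (2 * (‖v‖ + 1)), by positivity, ?_⟩
      rw [mem_ball_zero_iff, norm_smul, Real.norm_of_nonneg (by positivity), div_mul_eq_mul_div,
        div_lt_iff₀ (by positivity)]
      nlinarith [norm_nonneg v]
    have := (key _ hεv).trans hcon
    rw [map_smul, smul_eq_mul] at this
    nlinarith
  refine le_antisymm (hle v) ?_
  have := hle (-v)
  rw [map_neg] at this
  simpa using this

/-- The gauge of a bounded open convex neighbourhood of the origin with smooth boundary is smooth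
away from the origin. -/
theorem contDiffAt_gauge [CompleteSpace E] {K : Set E} (hK : IsSmoothConvexObstacle K)
    (h0 : (0 : E) ∈ K) {x : E} (hx : x ≠ 0) : ContDiffAt ℝ ∞ (gauge K) x := by
  have h0n : K ∈ 𝓝 (0 : E) := hK.isOpen.mem_nhds h0
  have habs : Absorbent ℝ K := absorbent_nhds_zero h0n
  have hcg : Continuous (gauge K) := continuous_gauge hK.convex h0n
  have hpos : ∀ z : E, z ≠ 0 → 0 < gauge K z := fun z hz =>
    (gauge_pos habs (NormedSpace.isVonNBounded_of_isBounded ℝ hK.bounded)).2 hz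
  have hfr : ∀ z : E, z ≠ 0 → (gauge K z)⁻¹ • z ∈ frontier K := by
    intro z hz
    rw [← gauge_eq_one_iff_mem_frontier hK.convex h0n, gauge_smul_of_nonneg
      (inv_nonneg.2 (gauge_nonneg z)), smul_eq_mul, inv_mul_cancel₀ (hpos z hz).ne']
  set y : E := (gauge K x)⁻¹ • x with hy
  obtain ⟨U, ρ, hUo, hyU, hρ, hne, hρK⟩ := hK.smooth y (hfr x hx)
  have hUn : U ∈ 𝓝 y := hUo.mem_nhds hyU
  have hρy : ContDiffAt ℝ ∞ ρ y := hρ.contDiffAt hUn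
  have hfd := fderiv_pos_of_convex hK.convex h0n hUn (hρy.differentiableAt (by simp)) hne
    (hfr x hx) hK.isOpen hρK
  have hzero : ∀ z ∈ U, z ∈ frontier K → ρ z = 0 := fun z hz hzf =>
    eq_zero_of_mem_frontier (hUo.mem_nhds hz) (hρ.contDiffAt (hUo.mem_nhds hz)).continuousAt
      hzf hK.isOpen hρK
  set τ : E → ℝ := fun z => (gauge K z)⁻¹ with hτ
  -- The ray through `z` leaves `K` at the parameter `τ z`, so `Φ (z, τ z) = (z, 0)`. The
  -- differential of `Φ` is triangular with the nonzero entry `fderiv ℝ ρ y x`, so the smooth local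
  -- inverse recovers `τ z` from `(z, 0)`.
  let Φ : E × ℝ → E × ℝ := fun z => (z.1, ρ (z.2 • z.1))
  have hΦs : ContDiffAt ℝ ∞ Φ (x, τ x) := by
    refine contDiffAt_fst.prodMk ?_
    have h1 : ContDiffAt ℝ ∞ (fun z : E × ℝ => z.2 • z.1) (x, τ x) :=
      contDiffAt_snd.smul contDiffAt_fst
    exact ContDiffAt.comp (x, τ x) (f := fun z : E × ℝ => z.2 • z.1) hρy h1
  have hL : 0 < fderiv ℝ ρ y x := by
    have : x = gauge K x • y := by
      rw [hy, smul_smul, mul_inv_cancel₀ (hpos x hx).ne', one_smul]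
    rw [this, map_smul, smul_eq_mul]
    exact mul_pos (hpos x hx) hfd
  let D : (E × ℝ) →L[ℝ] (E × ℝ) := (ContinuousLinearMap.fst ℝ E ℝ).prod
    ((fderiv ℝ ρ y).comp (τ x • ContinuousLinearMap.fst ℝ E ℝ +
      (ContinuousLinearMap.snd ℝ E ℝ).smulRight x))
  have hD : HasFDerivAt Φ D (x, τ x) := by
    refine hasFDerivAt_fst.prodMk ?_
    have h1 : HasFDerivAt (fun z : E × ℝ => z.2 • z.1) (τ x • ContinuousLinearMap.fst ℝ E ℝ +
      (ContinuousLinearMap.snd ℝ E ℝ).smulRight x) (x, τ x) :=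
      (hasFDerivAt_snd (𝕜 := ℝ) (E := E) (F := ℝ) (p := (x, τ x))).smul hasFDerivAt_fst
    exact HasFDerivAt.comp (x, τ x) (f := fun z : E × ℝ => z.2 • z.1) (g := ρ)
      (hρy.differentiableAt (by simp)).hasFDerivAt h1
  have hDapp : ∀ z, D z = (z.1, τ x * fderiv ℝ ρ y z.1 + z.2 * fderiv ℝ ρ y x) := by
    intro z; simp [D]
  let e : (E × ℝ) ≃L[ℝ] (E × ℝ) := ContinuousLinearEquiv.equivOfInverse D
    ((ContinuousLinearMap.fst ℝ E ℝ).prod ((fderiv ℝ ρ y x)⁻¹ • (ContinuousLinearMap.snd ℝ E ℝ -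
      τ x • (fderiv ℝ ρ y).comp (ContinuousLinearMap.fst ℝ E ℝ))))
    (fun z => by
      rw [hDapp]
      ext <;> simp
      field_simp)
    (fun z => by
      rw [hDapp]
      ext <;> simp
      field_simp
      ring)
  have he : HasFDerivAt Φ (e : (E × ℝ) →L[ℝ] (E × ℝ)) (x, τ x) := hD
  have hsymm := hΦs.to_localInverse he (by simp)
  have hΦx : Φ (x, τ x) = (x, 0) := Prod.ext rfl (hzero y hyU (hfr x hx))
  have hτc : ContinuousAt τ x := hcg.continuousAt.inv₀ (hpos x hx).ne'
  have hleft := (hΦs.hasStrictFDerivAt' he (by simp)).eventually_left_inverse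
  have hcurve : Tendsto (fun z : E => (z, τ z)) (𝓝 x) (𝓝 (x, τ x)) :=
    (continuousAt_id.prodMk hτc)
  have hxU : ∀ᶠ z in 𝓝 x, τ z • z ∈ U :=
    (hτc.smul continuousAt_id).tendsto hUn
  have hτs : ContDiffAt ℝ ∞ τ x := by
    rw [hΦx] at hsymm
    have h1 : ContDiffAt ℝ ∞ (fun z : E => (hΦs.localInverse he (by simp) (z, (0 : ℝ))).2) x := by
      refine contDiffAt_snd.comp x ?_
      exact ContDiffAt.comp x (f := fun z : E => (z, (0 : ℝ))) hsymm
        (contDiffAt_id.prodMk contDiffAt_const)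
    refine h1.congr_of_eventuallyEq ?_
    filter_upwards [hcurve.eventually hleft, hxU, eventually_ne_nhds hx] with z h2 h3 h4
    have h5 : Φ (z, τ z) = (z, 0) := Prod.ext rfl (hzero _ h3 (hfr z h4))
    rw [h5] at h2
    exact (congrArg Prod.snd h2).symm
  refine (hτs.inv (inv_ne_zero (hpos x hx).ne')).congr_of_eventuallyEq ?_
  exact Eventually.of_forall fun z => (inv_inv _).symm

theorem fderiv_gauge_self {K : Set E} {x : E} (h : DifferentiableAt ℝ (gauge K) x) :
    fderiv ℝ (gauge K) x x = gauge K x := by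
  have h1 : HasDerivAt (fun t : ℝ => x + t • x) x 0 := by
    simpa using ((hasDerivAt_id (0 : ℝ)).smul_const x).const_add x
  have h2 : HasFDerivAt (gauge K) (fderiv ℝ (gauge K) x) (x + (0 : ℝ) • x) := by
    simpa using h.hasFDerivAt
  have h3 := h2.comp_hasDerivAt (0 : ℝ) h1
  have h4 : HasDerivAt (fun t : ℝ => (1 + t) * gauge K x) (gauge K x) 0 := by
    simpa using ((hasDerivAt_id (0 : ℝ)).const_add 1).mul_const (gauge K x)
  refine h3.unique (h4.congr_of_eventuallyEq ?_)
  filter_upwards [Ioi_mem_nhds (show (-1 : ℝ) < 0 by norm_num)] with t ht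
  have ht' : 0 ≤ 1 + t := by linarith [mem_Ioi.1 ht]
  rw [← smul_eq_mul, ← gauge_smul_of_nonneg ht', add_smul, one_smul]
  rfl

/-- A convex function lies above its tangents; the difference quotients are bounded by the one at `t
= 1`. -/
theorem fderiv_gauge_le {K : Set E} (hc : Convex ℝ K) (h0 : K ∈ 𝓝 0) {x : E}
    (h : DifferentiableAt ℝ (gauge K) x) (v : E) :
    fderiv ℝ (gauge K) x v ≤ gauge K (x + v) - gauge K x := by
  have h1 : HasDerivAt (fun t : ℝ => x + t • v) v 0 := by
    simpa using ((hasDerivAt_id (0 : ℝ)).smul_const v).const_add x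
  have h2 : HasFDerivAt (gauge K) (fderiv ℝ (gauge K) x) (x + (0 : ℝ) • v) := by
    simpa using h.hasFDerivAt
  have hs := (h2.comp_hasDerivAt (0 : ℝ) h1).hasDerivWithinAt (s := Ioi 0)
  rw [hasDerivWithinAt_iff_tendsto_slope' (by simp)] at hs
  refine le_of_tendsto hs ?_
  filter_upwards [self_mem_nhdsWithin, nhdsWithin_le_nhds (Iic_mem_nhds zero_lt_one)] with t ht ht1
  have ht0 : (0 : ℝ) < t := ht
  have h3 : gauge K (x + t • v) ≤ (1 - t) * gauge K x + t * gauge K (x + v) := by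
    have h4 := gauge_add_le hc (absorbent_nhds_zero h0) ((1 - t) • x) (t • (x + v))
    rw [gauge_smul_of_nonneg (sub_nonneg.2 ht1), gauge_smul_of_nonneg ht0.le] at h4
    rw [show x + t • v = (1 - t) • x + t • (x + v) by module]
    exact h4
  simp only [slope_def_field, zero_smul, add_zero, sub_zero, Function.comp]
  rw [div_le_iff₀ ht0]
  linarith

theorem IsSmoothConvexObstacle.translate {O : Set E} (hO : IsSmoothConvexObstacle O) (o : E) :
    IsSmoothConvexObstacle ((fun x => x + o) ⁻¹' O) where
  nonempty := by
    obtain ⟨y, hy⟩ := hO.nonempty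
    exact ⟨y - o, by simpa using hy⟩
  isOpen := hO.isOpen.preimage (by fun_prop)
  convex := hO.convex.translate_preimage_left o
  bounded := by
    rw [show (fun x : E => x + o) ⁻¹' O = (fun x => x - o) '' O by
      ext x; constructor
      · intro h; exact ⟨x + o, h, by simp⟩
      · rintro ⟨y, hy, rfl⟩; simpa using hy]
    have hL : LipschitzWith 1 (fun x : E => x - o) := LipschitzWith.of_dist_le_mul fun x y => by simp
    exact hL.isBounded_image hO.bounded
  smooth := by
    intro x hx
    have hx' : x + o ∈ frontier O := by
      have := (Homeomorph.addRight o).preimage_frontier O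
      exact (Set.ext_iff.1 this x).2 hx
    obtain ⟨U, ρ, h1, h2, h3, h4, h5⟩ := hO.smooth _ hx'
    refine ⟨(fun x => x + o) ⁻¹' U, fun x => ρ (x + o), h1.preimage (by fun_prop), h2,
      h3.comp (contDiff_id.add contDiff_const).contDiffOn (fun _ h => h), ?_, fun y hy => h5 _ hy⟩
    rwa [fderiv_comp_add_right]

/-- A `C²` field of normals of half spaces which contain the points outside `O` in their boundary
and do not meet `O`, normalized by a star center `o` of `O`. -/
structure IsSupportField (O : Set E) (o : E) (a : E → E) : Prop where
  contDiffAt : ∀ x ∉ O, ContDiffAt ℝ 2 a x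
  inner_sub_center : ∀ x ∉ O, ⟪a x, x - o⟫ = 1
  inner_sub_neg : ∀ x ∉ O, ∀ y ∈ O, ⟪a x, y - x⟫ < 0

/-- The field is the gradient of the logarithm of the gauge centred at a point `o ∈ O`. Homogeneity
of the gauge gives the normalization. The tangent inequality gives the strict sign, since the gauge
is `< 1` on `O` and `≥ 1` outside. -/
theorem IsSmoothConvexObstacle.exists_isSupportField [CompleteSpace E] {O : Set E}
    (hO : IsSmoothConvexObstacle O) : ∃ o a, IsSupportField O o a := by
  obtain ⟨o, ho⟩ := hO.nonempty
  set K : Set E := (fun x => x + o) ⁻¹' O with hKdef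
  have hK : IsSmoothConvexObstacle K := hO.translate o
  have h0 : (0 : E) ∈ K := by simpa [hKdef] using ho
  have h0n : K ∈ 𝓝 (0 : E) := hK.isOpen.mem_nhds h0
  have hne : ∀ x ∉ O, x - o ≠ 0 := fun x hx h => hx (by rw [sub_eq_zero.1 h]; exact ho)
  have hmem : ∀ x, x - o ∈ K ↔ x ∈ O := fun x => by simp [hKdef]
  have hN1 : ∀ x ∉ O, 1 ≤ gauge K (x - o) := fun x hx =>
    one_le_gauge_of_notMem (hK.convex.starConvex h0) (absorbent_nhds_zero h0n _)
      (by rwa [hmem])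
  have hd : ∀ x ∉ O, ContDiffAt ℝ ∞ (gauge K) (x - o) := fun x hx =>
    contDiffAt_gauge hK h0 (hne x hx)
  refine ⟨o, fun x => (InnerProductSpace.toDual ℝ E).symm
    ((gauge K (x - o))⁻¹ • fderiv ℝ (gauge K) (x - o)), ?_, ?_, ?_⟩
  · intro x hx
    refine (InnerProductSpace.toDual ℝ E).symm.contDiff.contDiffAt.comp x ?_
    have hs : ContDiffAt ℝ 2 (fun x : E => x - o) x := contDiffAt_id.sub contDiffAt_const
    have h1 : ContDiffAt ℝ 2 (gauge K) (x - o) := by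
      exact_mod_cast contDiffAt_infty.1 (hd x hx) 2
    have h2 : ContDiffAt ℝ 2 (fderiv ℝ (gauge K)) (x - o) := by
      exact_mod_cast contDiffAt_infty.1 ((hd x hx).fderiv_right (m := ∞) le_rfl) 2
    have h3 : ContDiffAt ℝ 2 (gauge K ∘ fun x => x - o) x := h1.comp x hs
    have h4 := h3.inv (show (gauge K ∘ fun x => x - o) x ≠ 0 from
      (zero_lt_one.trans_le (hN1 x hx)).ne')
    exact h4.smul (h2.comp x hs)
  · intro x hx
    have hpos : 0 < gauge K (x - o) := by linarith [hN1 x hx]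
    rw [InnerProductSpace.toDual_symm_apply]
    simp only [_root_.smul_apply, smul_eq_mul]
    rw [fderiv_gauge_self ((hd x hx).differentiableAt (by simp)), inv_mul_cancel₀ hpos.ne']
  · intro x hx y hy
    have hpos : 0 < gauge K (x - o) := by linarith [hN1 x hx]
    rw [InnerProductSpace.toDual_symm_apply]
    simp only [_root_.smul_apply, smul_eq_mul]
    refine mul_neg_of_pos_of_neg (inv_pos.2 hpos) ?_
    have h1 := fderiv_gauge_le hK.convex h0n ((hd x hx).differentiableAt (by simp)) (y - x)
    have h2 : gauge K (y - o) < 1 := gauge_lt_one_of_mem_of_isOpen hK.isOpen ((hmem y).2 hy)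
    rw [show x - o + (y - x) = y - o by abel] at h1
    linarith [hN1 x hx]

end Support

/-! ### Square integrable functions on an interval. -/

section SquareIntegrable

theorem memLp_restrict_mono {F : Type*} [NormedAddCommGroup F] {f : ℝ → F} {c d c' d' : ℝ} (hf : MemLp f 2 (volume.restrict (Icc c d)))
    (hc : c ≤ c') (hd : d' ≤ d) : MemLp f 2 (volume.restrict (Icc c' d')) :=
  hf.mono_measure (Measure.restrict_mono (Icc_subset_Icc hc hd) le_rfl)

variable {F : Type*} [NormedAddCommGroup F] [InnerProductSpace ℝ F] {c d : ℝ}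

theorem intervalIntegrable_inner {f h : ℝ → F} (hcd : c ≤ d)
    (hf : MemLp f 2 (volume.restrict (Icc c d))) (hh : MemLp h 2 (volume.restrict (Icc c d))) :
    IntervalIntegrable (fun t => ⟪f t, h t⟫) volume c d := by
  rw [intervalIntegrable_iff_integrableOn_Icc_of_le hcd]
  refine Integrable.mono' (hf.norm.integrable_mul hh.norm) (hf.1.inner hh.1) ?_
  exact Eventually.of_forall fun t => norm_inner_le_norm _ _

theorem intervalIntegrable_norm_sq {f : ℝ → F} (hcd : c ≤ d)
    (hf : MemLp f 2 (volume.restrict (Icc c d))) :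
    IntervalIntegrable (fun t => ‖f t‖ ^ 2) volume c d := by
  simpa only [real_inner_self_eq_norm_sq] using intervalIntegrable_inner hcd hf hf

theorem integral_norm_add_smul_sq {f h : ℝ → F} (hcd : c ≤ d)
    (hf : MemLp f 2 (volume.restrict (Icc c d))) (hh : MemLp h 2 (volume.restrict (Icc c d)))
    (r : ℝ) : ∫ t in c..d, ‖f t + r • h t‖ ^ 2 =
      (∫ t in c..d, ‖f t‖ ^ 2) + 2 * r * (∫ t in c..d, ⟪f t, h t⟫) +
        r ^ 2 * ∫ t in c..d, ‖h t‖ ^ 2 := by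
  have e : ∀ t, ‖f t + r • h t‖ ^ 2 = ‖f t‖ ^ 2 + 2 * r * ⟪f t, h t⟫ + r ^ 2 * ‖h t‖ ^ 2 := by
    intro t
    rw [norm_add_sq_real, inner_smul_right, norm_smul, mul_pow, Real.norm_eq_abs, sq_abs]
    ring
  have i1 := intervalIntegrable_norm_sq hcd hf
  have i2 := (intervalIntegrable_inner hcd hf hh).const_mul (2 * r)
  have i3 := (intervalIntegrable_norm_sq hcd hh).const_mul (r ^ 2)
  simp only [e]
  rw [intervalIntegral.integral_add (i1.add i2) i3, intervalIntegral.integral_add i1 i2,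
    intervalIntegral.integral_const_mul, intervalIntegral.integral_const_mul]

theorem memLp_fderiv_comp {G : Type*} [NormedAddCommGroup G] [NormedSpace ℝ G] {u g : ℝ → F}
    (hu : ContinuousOn u (Icc c d)) (hg : MemLp g 2 (volume.restrict (Icc c d))) {Φ : F → G}
    (hΦ : ∀ t ∈ Icc c d, ContDiffAt ℝ 1 Φ (u t)) :
    MemLp (fun t => fderiv ℝ Φ (u t) (g t)) 2 (volume.restrict (Icc c d)) := by
  have hcont : ContinuousOn (fun t => fderiv ℝ Φ (u t)) (Icc c d) := fun t ht =>
    ((hΦ t ht).continuousAt_fderiv (by simp)).comp_continuousWithinAt (hu t ht)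
  obtain ⟨C, hC⟩ := isCompact_Icc.exists_bound_of_continuousOn hcont
  refine hg.of_le_mul (c := C) ((ContinuousLinearMap.apply ℝ G).flip.aestronglyMeasurable_comp₂
    (hcont.aestronglyMeasurable measurableSet_Icc) hg.1) ?_
  filter_upwards [ae_restrict_mem measurableSet_Icc] with t ht
  exact (ContinuousLinearMap.le_opNorm _ _).trans
    (mul_le_mul_of_nonneg_right (hC t ht) (norm_nonneg _))

theorem memLp_of_continuousOn {G : Type*} [NormedAddCommGroup G] {f : ℝ → G}
    (hf : ContinuousOn f (Icc c d)) : MemLp f 2 (volume.restrict (Icc c d)) := by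
  obtain ⟨C, hC⟩ := isCompact_Icc.exists_bound_of_continuousOn hf
  refine MemLp.of_bound (hf.aestronglyMeasurable measurableSet_Icc) C ?_
  filter_upwards [ae_restrict_mem measurableSet_Icc] with t ht using hC t ht

theorem memLp_continuousOn_smul {φ : ℝ → ℝ} {f : ℝ → F} (hφ : ContinuousOn φ (Icc c d))
    (hf : MemLp f 2 (volume.restrict (Icc c d))) :
    MemLp (fun t => φ t • f t) 2 (volume.restrict (Icc c d)) := by
  obtain ⟨C, hC⟩ := isCompact_Icc.exists_bound_of_continuousOn hφ
  refine hf.of_le_mul (c := C) ((hφ.aestronglyMeasurable measurableSet_Icc).smul hf.1) ?_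
  filter_upwards [ae_restrict_mem measurableSet_Icc] with t ht
  rw [norm_smul]
  exact mul_le_mul_of_nonneg_right (hC t ht) (norm_nonneg _)

theorem intervalIntegral_eq_of_subinterval {G : Type*} [NormedAddCommGroup G] [NormedSpace ℝ G]
    {f : ℝ → G} {c' d' : ℝ} (hc : c ≤ c') (hcd : c' ≤ d') (hd : d' ≤ d)
    (hf : ∀ t ∉ Ioo c' d', f t = 0) : ∫ t in c..d, f t = ∫ t in c'..d', f t := by
  rw [intervalIntegral.integral_of_le (hc.trans (hcd.trans hd)), intervalIntegral.integral_of_le hcd,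
    setIntegral_eq_integral_of_forall_compl_eq_zero, setIntegral_eq_integral_of_forall_compl_eq_zero]
  · exact fun t ht => hf t fun h => ht (Ioo_subset_Ioc_self h)
  · exact fun t ht => hf t fun h => ht ⟨hc.trans_lt h.1, h.2.le.trans hd⟩

end SquareIntegrable

/-! ### Affine pieces and their strict minimality for the energy. -/

section Affine

variable {E : Type*} [NormedAddCommGroup E] [InnerProductSpace ℝ E] {u g : ℝ → E} {c d : ℝ}

/-- `u` is affine on `[c, d]` with velocity `k`. -/
def IsAffineOn (u : ℝ → E) (k : E) (c d : ℝ) : Prop :=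
  ∀ t ∈ Icc c d, u t = u c + (t - c) • k

theorem isAffineOn_of_ae_eq [CompleteSpace E] (hu : IsPrimitiveOn u g c d) {k : E}
    (hk : ∀ᵐ t, t ∈ Ioo c d → g t = k) : IsAffineOn u k c d := by
  intro t ht
  rw [(hu.congr_deriv hk).eq t ht, intervalIntegral.integral_const]

theorem IsAffineOn.isPrimitiveOn [CompleteSpace E] {k : E} (h : IsAffineOn u k c d) (hcd : c ≤ d) :
    IsPrimitiveOn u (fun _ => k) c d :=
  ⟨hcd, intervalIntegrable_const, fun t ht => by rw [intervalIntegral.integral_const, h t ht]⟩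

/-- The energy of a curve exceeds the one of the affine curve with velocity `k` and the same
endpoints by the energy of the difference. -/
theorem IsPrimitiveOn.integral_norm_sub_sq (hu : IsPrimitiveOn u g c d) [CompleteSpace E]
    (hg : MemLp g 2 (volume.restrict (Icc c d))) {k : E} (hk : u d = u c + (d - c) • k) :
    ∫ t in c..d, ‖g t - k‖ ^ 2 = (∫ t in c..d, ‖g t‖ ^ 2) - (d - c) * ‖k‖ ^ 2 := by
  have h1 := integral_norm_add_smul_sq hu.le hg (memLp_of_continuousOn
    (continuousOn_const (c := k))) (-1)
  have h2 : ∫ t in c..d, ⟪g t, k⟫ = (d - c) * ‖k‖ ^ 2 := by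
    have h3 : ∫ t in c..d, g t = (d - c) • k := by
      have := hu.eq d (right_mem_Icc.2 hu.le)
      rw [hk] at this
      exact (add_left_cancel this).symm
    simp only [real_inner_comm k]
    rw [intervalIntegral.integral_of_le hu.le, integral_inner hu.integrable.1,
      ← intervalIntegral.integral_of_le hu.le, h3, inner_smul_right, real_inner_self_eq_norm_sq]
  simp only [neg_smul, one_smul, ← sub_eq_add_neg] at h1
  rw [h1, h2, intervalIntegral.integral_const, smul_eq_mul]
  ring

/-- The energy excess over the affine curve equals the squared `L²` norm of `g - k`, so no excess
forces `g = k` almost everywhere. -/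
theorem IsPrimitiveOn.isAffineOn_of_energy_le (hu : IsPrimitiveOn u g c d) [CompleteSpace E]
    (hg : MemLp g 2 (volume.restrict (Icc c d))) {k : E} (hk : u d = u c + (d - c) • k)
    (hle : ∫ t in c..d, ‖g t‖ ^ 2 ≤ (d - c) * ‖k‖ ^ 2) : IsAffineOn u k c d := by
  have h1 := hu.integral_norm_sub_sq hg hk
  have hm : MemLp (fun t => g t - k) 2 (volume.restrict (Icc c d)) :=
    hg.sub (memLp_of_continuousOn continuousOn_const)
  have hi := intervalIntegrable_norm_sq hu.le hm
  have hnn : 0 ≤ ∫ t in c..d, ‖g t - k‖ ^ 2 :=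
    intervalIntegral.integral_nonneg hu.le fun t _ => by positivity
  have h0 : ∫ t in c..d, ‖g t - k‖ ^ 2 = 0 := le_antisymm (by linarith) hnn
  rw [intervalIntegral.integral_of_le hu.le, integral_eq_zero_iff_of_nonneg
    (fun t => by positivity) hi.1] at h0
  refine isAffineOn_of_ae_eq hu ?_
  filter_upwards [(ae_restrict_iff' measurableSet_Ioc).1 h0] with t ht htI
  have := ht (Ioo_subset_Ioc_self htI)
  simpa [sub_eq_zero] using this

theorem IsPrimitiveOn.energy_of_isAffineOn [CompleteSpace E] (hu : IsPrimitiveOn u g c d) {k : E}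
    (h : IsAffineOn u k c d) : ∫ t in c..d, ‖g t‖ ^ 2 = (d - c) * ‖k‖ ^ 2 := by
  have h1 : ∫ t in c..d, ‖g t‖ ^ 2 = ∫ t in c..d, ‖k‖ ^ 2 := by
    refine intervalIntegral.integral_congr_ae ?_
    have h₂ : ∀ᵐ x : ℝ, x ≠ d := by simp [ae_iff, measure_singleton]
    filter_upwards [hu.ae_eq_deriv (h.isPrimitiveOn hu.le) (fun _ _ => rfl), h₂] with t h3 h4 h5
    rw [uIoc_of_le hu.le] at h5
    rw [h3 ⟨h5.1, lt_of_le_of_ne h5.2 h4⟩]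
  rw [h1, intervalIntegral.integral_const, smul_eq_mul]

end Affine

/-! ### First variation, free motion and the interval of contact times. -/

section Variation

variable {E : Type*} [NormedAddCommGroup E] [InnerProductSpace ℝ E] {O : Set E} {p q : E}
  {u g : ℝ → E}

/-- The energy of `u + r η` is quadratic in `r`. As both signs of `r` are admissible, it has a local
minimum at `r = 0`, and its linear coefficient vanishes. -/
theorem IsMinCurve.integral_inner_eq_zero (h : IsMinCurve O p q u g) {η ζ : ℝ → E}
    (hη : IsPrimitiveOn η ζ 0 1) (hζ : MemLp ζ 2 (volume.restrict (Icc 0 1)))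
    (h0 : η 0 = 0) (h1 : η 1 = 0)
    (hadm : ∀ᶠ r : ℝ in 𝓝 0, ∀ t ∈ Icc (0 : ℝ) 1, u t + r • η t ∉ O) :
    ∫ t in (0 : ℝ)..1, ⟪g t, ζ t⟫ = 0 := by
  set A := ∫ t in (0 : ℝ)..1, ⟪g t, ζ t⟫
  set B := ∫ t in (0 : ℝ)..1, ‖ζ t‖ ^ 2
  have hmin : IsLocalMin (fun r : ℝ => 2 * r * A + r ^ 2 * B) 0 := by
    filter_upwards [hadm] with r hr
    have hle := h.le _ _ ⟨h.prim.add_smul hη r, h.memLp.add (hζ.const_smul r),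
      by simp [h0, h.zero], by simp [h1, h.one], hr⟩
    rw [integral_norm_add_smul_sq zero_le_one h.memLp hζ] at hle
    simp only [mul_zero, zero_mul, ne_eq, OfNat.ofNat_ne_zero, not_false_eq_true, zero_pow, add_zero]
    linarith
  have hd : HasDerivAt (fun r : ℝ => 2 * r * A + r ^ 2 * B) (2 * A) 0 := by
    have e1 := ((hasDerivAt_id (0 : ℝ)).const_mul 2).mul_const A
    have e2 := ((hasDerivAt_id (0 : ℝ)).pow 2).mul_const B
    exact (e1.add e2).congr_deriv (by simp)
  have := hmin.hasDerivAt_eq_zero hd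
  linarith

theorem integral_eq_zero_of_inner {f : ℝ → E} [CompleteSpace E] {c d : ℝ} (hcd : c ≤ d)
    (hf : IntervalIntegrable f volume c d) (h : ∀ v : E, ∫ t in c..d, ⟪v, f t⟫ = 0) :
    ∫ t in c..d, f t = 0 := by
  rw [intervalIntegral.integral_of_le hcd]
  refine integral_eq_zero_of_forall_integral_inner_eq_zero ℝ _ hf.1 fun v => ?_
  rw [← intervalIntegral.integral_of_le hcd, h v]

theorem contDiff_infty_deriv {φ : ℝ → ℝ} (h : ContDiff ℝ ∞ φ) : ContDiff ℝ ∞ (deriv φ) := by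
  rw [show (∞ : WithTop ℕ∞) = ∞ + 1 from rfl, contDiff_succ_iff_deriv] at h
  exact h.2.2

theorem eq_zero_of_tsupport_subset {φ : ℝ → ℝ} {s : Set ℝ} (h : tsupport φ ⊆ s) {t : ℝ}
    (ht : t ∉ s) : φ t = 0 :=
  image_eq_zero_of_notMem_tsupport fun h' => ht (h h')

theorem deriv_eq_zero_of_tsupport_subset {φ : ℝ → ℝ} {s : Set ℝ} (h : tsupport φ ⊆ s) {t : ℝ}
    (ht : t ∉ s) : deriv φ t = 0 :=
  image_eq_zero_of_notMem_tsupport fun h' => ht (h (tsupport_deriv_subset h'))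

/-- A minimizing curve is affine on the time intervals on which it does not touch the obstacle. -/
theorem IsMinCurve.exists_isAffineOn [CompleteSpace E] (h : IsMinCurve O p q u g) {c d : ℝ}
    (hc : 0 ≤ c) (hcd : c < d) (hd : d ≤ 1) (hfree : ∀ t ∈ Ioo c d, u t ∉ closure O) :
    ∃ k, IsAffineOn u k c d := by
  have hp := h.prim.mono hc hcd.le hd
  -- The image under `u` of the support of a test function has positive distance from `closure O`,
  -- so small variations in any fixed direction `v` are admissible. Thus the velocity has weak
  -- derivative zero and is constant.
  obtain ⟨W, hW, hae⟩ := exists_primitive_of_weakDeriv hcd hp.integrable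
    (h := fun _ => (0 : E)) intervalIntegrable_const (fun φ h1 h2 => by
      have hφ' := contDiff_infty_deriv h1
      simp only [smul_zero, intervalIntegral.integral_zero, neg_zero]
      have h2' : tsupport φ ⊆ Ioo 0 1 := h2.trans (Ioo_subset_Ioo hc hd)
      rw [← intervalIntegral_eq_of_subinterval hc hcd.le hd (fun t ht => by
        rw [deriv_eq_zero_of_tsupport_subset h2 ht, zero_smul])]
      refine integral_eq_zero_of_inner zero_le_one
        (h.prim.integrable.continuousOn_smul hφ'.continuous.continuousOn) fun v => ?_
      have hη : IsPrimitiveOn (fun t => φ t • v) (fun t => deriv φ t • v) 0 1 := by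
        have hv : IsPrimitiveOn (fun _ => v) (fun _ => (0 : E)) 0 1 :=
          ⟨zero_le_one, intervalIntegrable_const, fun t _ => by simp⟩
        simpa using hv.smul (h1.of_le (by simp))
      have hvar := h.integral_inner_eq_zero hη
        (memLp_of_continuousOn (hφ'.continuous.continuousOn.smul continuousOn_const))
        (by rw [eq_zero_of_tsupport_subset h2' (by simp), zero_smul])
        (by rw [eq_zero_of_tsupport_subset h2' (by simp), zero_smul]) (by
          have hK : IsCompact (tsupport φ) := isCompact_Icc.of_isClosed_subset
            (isClosed_tsupport φ) (h2.trans Ioo_subset_Icc_self)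
          have huK : IsCompact (u '' tsupport φ) := hK.image_of_continuousOn
            (h.prim.continuousOn.mono (h2'.trans Ioo_subset_Icc_self))
          obtain ⟨δ, hδ, hth⟩ := huK.exists_thickening_subset_open
            (isClosed_closure (s := O)).isOpen_compl (by
              rintro _ ⟨t, ht, rfl⟩
              exact hfree t (h2 ht))
          obtain ⟨C, hC⟩ := (isCompact_Icc (a := (0 : ℝ)) (b := 1)).exists_bound_of_continuousOn
            (f := fun t => φ t • v) (h1.continuous.continuousOn.smul continuousOn_const)
          have hC0 : 0 ≤ C := (norm_nonneg _).trans (hC 0 (by simp))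
          filter_upwards [Metric.ball_mem_nhds (0 : ℝ) (show 0 < δ / (C + 1) by positivity)]
            with r hr t ht
          rw [mem_ball_zero_iff, lt_div_iff₀ (by positivity)] at hr
          by_cases htφ : t ∈ tsupport φ
          · intro hO
            refine hth ?_ (subset_closure hO)
            rw [Metric.mem_thickening_iff]
            refine ⟨u t, mem_image_of_mem _ htφ, ?_⟩
            rw [dist_eq_norm, add_sub_cancel_left, norm_smul]
            calc ‖r‖ * ‖φ t • v‖ ≤ ‖r‖ * C := by gcongr; exact hC t ht
              _ ≤ ‖r‖ * (C + 1) := by gcongr; linarith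
              _ < δ := hr
          · rw [image_eq_zero_of_notMem_tsupport htφ, zero_smul, smul_zero, add_zero]
            exact h.notMem t ht)
      simpa only [inner_smul_right, real_inner_comm v] using hvar)
  refine ⟨W c, isAffineOn_of_ae_eq hp ?_⟩
  filter_upwards [hae] with t ht htI
  rw [ht htI, hW.eq t (Ioo_subset_Icc_self htI)]
  simp

/-- The set of contact times of a minimizing curve with a convex obstacle is an interval. -/
theorem IsMinCurve.mem_closure_of_mem_Icc [CompleteSpace E] (hO : Convex ℝ O)
    (h : IsMinCurve O p q u g) {s t r : ℝ} (hs : 0 ≤ s) (hr : r ≤ 1) (ht : t ∈ Icc s r)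
    (hus : u s ∈ closure O) (hur : u r ∈ closure O) : u t ∈ closure O := by
  by_contra hut
  have hclosed : ∀ {c d : ℝ}, 0 ≤ c → d ≤ 1 → IsCompact (Icc c d ∩ u ⁻¹' closure O) :=
    fun hc hd => isCompact_Icc.of_isClosed_subset
      ((h.prim.continuousOn.mono (Icc_subset_Icc hc hd)).preimage_isClosed_of_isClosed isClosed_Icc
        isClosed_closure) inter_subset_left
  -- Around a contact-free time `t`, let `c` be the last contact before it and `d` the first one
  -- after it. The curve is affine in between, so `u t` lies on a chord of the convex set `closure
  -- O`.
  obtain ⟨c, hc, hcmax⟩ := (hclosed hs (ht.2.trans hr)).exists_isGreatest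
    ⟨s, left_mem_Icc.2 ht.1, hus⟩
  obtain ⟨d, hd, hdmin⟩ := (hclosed (hs.trans ht.1) hr).exists_isLeast
    ⟨r, right_mem_Icc.2 ht.2, hur⟩
  have hct : c < t := lt_of_le_of_ne hc.1.2 fun e => hut (e ▸ hc.2)
  have htd : t < d := lt_of_le_of_ne hd.1.1 fun e => hut (e ▸ hd.2)
  obtain ⟨k, hk⟩ := h.exists_isAffineOn (hs.trans hc.1.1) (hct.trans htd) (hd.1.2.trans hr) (by
    intro x hx hxO
    rcases le_total x t with hxt | hxt
    · exact not_lt.2 (hcmax ⟨⟨hc.1.1.trans hx.1.le, hxt⟩, hxO⟩) hx.1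
    · exact not_lt.2 (hdmin ⟨⟨hxt, hx.2.le.trans hd.1.2⟩, hxO⟩) hx.2)
  refine hut (hO.closure.segment_subset hc.2 hd.2 ?_)
  have hcd : 0 < d - c := by linarith
  rw [segment_eq_image']
  refine ⟨(t - c) / (d - c), ⟨by apply div_nonneg <;> linarith, by
    rw [div_le_one hcd]; linarith⟩, ?_⟩
  rw [hk t ⟨hct.le, htd.le⟩, hk d ⟨(hct.trans htd).le, le_rfl⟩]
  simp only [add_sub_cancel_left, smul_smul]
  rw [div_mul_cancel₀ _ hcd.ne']

end Variation

/-! ### Euler-Lagrange equation and the ODE along the obstacle. -/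

section Momentum

variable {E : Type*} [NormedAddCommGroup E] [InnerProductSpace ℝ E] {O : Set E} {p q o : E}
  {a : E → E} {u g : ℝ → E}

/-- The component of the velocity `w` at `x` which is not influenced by the obstacle. -/
def momentum (o : E) (a : E → E) (x w : E) : E := w - ⟪x - o, w⟫ • a x

/-- The negative of the rate of change of the momentum. -/
def force (o : E) (a : E → E) (x w : E) : E := ⟪x - o, w⟫ • fderiv ℝ a x w + ‖w‖ ^ 2 • a x

/-- The velocity tangent to the obstacle which corresponds to the momentum `m`. -/
def contactVelocity (a : E → E) (x m : E) : E := m - (⟪a x, m⟫ / ‖a x‖ ^ 2) • a x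

/-- Momentum and velocity differ by a multiple of `a x`, which the orthogonal projection along `a x`
removes. -/
theorem contactVelocity_momentum {x w : E} (hx : a x ≠ 0) (hw : ⟪a x, w⟫ = 0) :
    contactVelocity a x (momentum o a x w) = w := by
  have : ‖a x‖ ^ 2 ≠ 0 := by simpa using hx
  rw [contactVelocity, momentum, inner_sub_right, inner_smul_right, real_inner_self_eq_norm_sq, hw,
    zero_sub, neg_div, mul_div_cancel_right₀ _ this, neg_smul]
  abel

theorem IsSupportField.ne_zero (ha : IsSupportField O o a) {x : E} (hx : x ∉ O) : a x ≠ 0 := by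
  intro h
  have := ha.inner_sub_center x hx
  simp [h] at this

/-- The whole hyperplane through `x` orthogonal to `a x` misses `O`, so tangential variations need
no smallness. -/
theorem IsSupportField.add_notMem (ha : IsSupportField O o a) {x h : E} (hx : x ∉ O)
    (hh : ⟪a x, h⟫ = 0) : x + h ∉ O := by
  intro hO
  have := ha.inner_sub_neg x hx _ hO
  rw [add_sub_cancel_left, hh] at this
  exact lt_irrefl _ this

theorem IsSupportField.inner_sub_nonpos (ha : IsSupportField O o a) {x y : E} (hx : x ∉ O)
    (hy : y ∈ closure O) : ⟪a x, y - x⟫ ≤ 0 := by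
  have hc : IsClosed {y : E | ⟪a x, y - x⟫ ≤ 0} :=
    isClosed_le (continuous_const.inner (continuous_id.sub continuous_const)) continuous_const
  exact closure_minimal (fun y hy => (ha.inner_sub_neg x hx y hy).le) hc hy

/-- Because `⟪a x, x - o⟫ = 1`, the field `v - ⟪v, a x⟫ • (x - o)` is the projection of `v` along `x
- o` to the hyperplane orthogonal to `a x`. It supplies the variations for the Euler-Lagrange
equation. -/
theorem IsSupportField.hasFDerivAt_tangent (ha : IsSupportField O o a) {x : E} (hx : x ∉ O)
    (v : E) : HasFDerivAt (fun x => v - ⟪v, a x⟫ • (x - o))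
      (-(⟪v, a x⟫ • ContinuousLinearMap.id ℝ E +
        ((innerSL ℝ v).comp (fderiv ℝ a x)).smulRight (x - o))) x := by
  have h1 : HasFDerivAt a (fderiv ℝ a x) x :=
    ((ha.contDiffAt x hx).differentiableAt (by simp)).hasFDerivAt
  have h2 : HasFDerivAt (fun x => ⟪v, a x⟫) ((innerSL ℝ v).comp (fderiv ℝ a x)) x :=
    ((innerSL ℝ v).hasFDerivAt).comp x h1
  exact (h2.smul ((hasFDerivAt_id x).sub_const o)).const_sub v

theorem IsSupportField.contDiffAt_tangent (ha : IsSupportField O o a) {x : E} (hx : x ∉ O)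
    (v : E) : ContDiffAt ℝ 1 (fun x => v - ⟪v, a x⟫ • (x - o)) x :=
  contDiffAt_const.sub ((contDiffAt_const.inner ℝ
    ((ha.contDiffAt x hx).of_le (by norm_num))).smul (contDiffAt_id.sub contDiffAt_const))

theorem continuousOn_supportField (ha : IsSupportField O o a) {c d : ℝ}
    (hu : ContinuousOn u (Icc c d)) (hO : ∀ t ∈ Icc c d, u t ∉ O) :
    ContinuousOn (fun t => a (u t)) (Icc c d) := fun t ht =>
  (ha.contDiffAt _ (hO t ht)).continuousAt.comp_continuousWithinAt (hu t ht)

theorem intervalIntegrable_smul_continuousOn {c d : ℝ} (hcd : c ≤ d) {f : ℝ → ℝ} {w : ℝ → E}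
    (hf : IntervalIntegrable f volume c d) (hw : ContinuousOn w (Icc c d)) :
    IntervalIntegrable (fun t => f t • w t) volume c d :=
  hf.smul_continuousOn (by rwa [uIcc_of_le hcd])

theorem IsCurve.intervalIntegrable_inner (h : IsCurve O p q u g) {w : ℝ → E}
    (hw : MemLp w 2 (volume.restrict (Icc 0 1))) :
    IntervalIntegrable (fun t => ⟪w t, g t⟫) volume 0 1 :=
  Obstacle.intervalIntegrable_inner zero_le_one hw h.memLp

theorem IsCurve.intervalIntegrable_momentum (ha : IsSupportField O o a) (h : IsCurve O p q u g) :
    IntervalIntegrable (fun t => momentum o a (u t) (g t)) volume 0 1 := by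
  refine h.prim.integrable.sub (intervalIntegrable_smul_continuousOn zero_le_one
    (h.intervalIntegrable_inner ?_) (continuousOn_supportField ha h.prim.continuousOn h.notMem))
  exact memLp_of_continuousOn (h.prim.continuousOn.sub continuousOn_const)

theorem IsCurve.intervalIntegrable_force (ha : IsSupportField O o a) (h : IsCurve O p q u g) :
    IntervalIntegrable (fun t => force o a (u t) (g t)) volume 0 1 := by
  refine IntervalIntegrable.add ?_ (intervalIntegrable_smul_continuousOn zero_le_one
    (intervalIntegrable_norm_sq zero_le_one h.memLp)
    (continuousOn_supportField ha h.prim.continuousOn h.notMem))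
  have hd : MemLp (fun t => fderiv ℝ a (u t) (g t)) 2 (volume.restrict (Icc 0 1)) :=
    memLp_fderiv_comp h.prim.continuousOn h.memLp fun t ht =>
      (ha.contDiffAt _ (h.notMem t ht)).of_le (by norm_num)
  have hu : ContinuousOn (fun t => u t - o) (Icc 0 1) :=
    h.prim.continuousOn.sub continuousOn_const
  obtain ⟨C, hC⟩ := isCompact_Icc.exists_bound_of_continuousOn hu
  rw [intervalIntegrable_iff_integrableOn_Icc_of_le zero_le_one]
  refine Integrable.mono' ((h.memLp.norm.integrable_mul hd.norm).const_mul C)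
    ((((hu.aestronglyMeasurable measurableSet_Icc).inner h.memLp.1)).smul hd.1) ?_
  filter_upwards [ae_restrict_mem measurableSet_Icc] with t ht
  rw [norm_smul]
  simp only [Pi.mul_apply]
  rw [← mul_assoc]
  refine mul_le_mul_of_nonneg_right ?_ (norm_nonneg _)
  exact (norm_inner_le_norm _ _).trans (mul_le_mul_of_nonneg_right (hC t ht) (norm_nonneg _))

/-- The Euler-Lagrange equation: the momentum of a minimizing curve has a continuous
representative, which is a primitive of the negative force. -/
theorem IsMinCurve.exists_momentum [CompleteSpace E] (ha : IsSupportField O o a)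
    (h : IsMinCurve O p q u g) : ∃ M : ℝ → E,
      IsPrimitiveOn M (fun t => -force o a (u t) (g t)) 0 1 ∧
        ∀ᵐ t, t ∈ Ioo (0 : ℝ) 1 → momentum o a (u t) (g t) = M t := by
  have hi := h.toIsCurve.intervalIntegrable_momentum ha
  have hf := h.toIsCurve.intervalIntegrable_force ha
  refine exists_primitive_of_weakDeriv zero_lt_one hi hf.neg fun φ h1 h2 => ?_
  have hφ' := contDiff_infty_deriv h1
  have i1 := hi.continuousOn_smul hφ'.continuous.continuousOn
  have i2 := hf.continuousOn_smul h1.continuous.continuousOn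
  simp only [smul_neg, intervalIntegral.integral_neg, neg_neg]
  rw [← sub_eq_zero, ← intervalIntegral.integral_sub i1 i2]
  refine integral_eq_zero_of_inner zero_le_one (i1.sub i2) fun v => ?_
  have hη := (h.prim.comp (Φ := fun x => v - ⟪v, a x⟫ • (x - o)) fun t ht =>
    ha.contDiffAt_tangent (h.notMem t ht) v)
  have hout : ∀ t, t ∉ Ioo (0 : ℝ) 1 → φ t = 0 := fun t ht => eq_zero_of_tsupport_subset h2 ht
  -- Pairing `g` with the derivative of this variation gives `⟪v, φ' • momentum - φ • force⟫`; as
  -- `v` is arbitrary, this is the weak equation for the momentum.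
  have hvar := h.integral_inner_eq_zero (hη.smul (φ := φ) (h1.of_le (by simp)))
    ((memLp_of_continuousOn (hφ'.continuous.continuousOn.smul hη.continuousOn)).add
      (memLp_continuousOn_smul h1.continuous.continuousOn (memLp_fderiv_comp h.prim.continuousOn
        h.memLp fun t ht => ha.contDiffAt_tangent (h.notMem t ht) v)))
    (by rw [hout 0 (by simp), zero_smul]) (by rw [hout 1 (by simp), zero_smul])
    (Eventually.of_forall fun r t ht => ha.add_notMem (h.notMem t ht) (by
      rw [inner_smul_right, inner_smul_right, inner_sub_right, inner_smul_right,
        ha.inner_sub_center _ (h.notMem t ht), real_inner_comm]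
      ring))
  refine Eq.trans (intervalIntegral.integral_congr fun t ht => ?_) hvar
  rw [uIcc_of_le zero_le_one] at ht
  rw [(ha.hasFDerivAt_tangent (h.notMem t ht) v).fderiv]
  simp only [momentum, force, _root_.neg_apply, _root_.add_apply,
    _root_.smul_apply, ContinuousLinearMap.id_apply,
    ContinuousLinearMap.smulRight_apply, ContinuousLinearMap.comp_apply, innerSL_apply_apply,
    inner_sub_right, inner_add_right, inner_smul_right, inner_neg_right,
    real_inner_self_eq_norm_sq, real_inner_comm v (g t), real_inner_comm (u t) (g t),
    real_inner_comm o (g t), inner_sub_left]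
  ring

/-- During contact the curve stays in the supporting half space at `u t`, so `⟪a (u t), u s - u t⟫`
is maximal at `s = t`. -/
theorem IsCurve.inner_supportField_eq_zero [CompleteSpace E] (ha : IsSupportField O o a)
    (h : IsCurve O p q u g) {c d : ℝ} (hc : 0 ≤ c) (hcd : c ≤ d) (hd : d ≤ 1)
    (hcontact : ∀ t ∈ Icc c d, u t ∈ closure O) :
    ∀ᵐ t, t ∈ Ioo c d → ⟪a (u t), g t⟫ = 0 := by
  filter_upwards [(h.prim.mono hc hcd hd).ae_hasDerivAt] with t ht htI
  have hut : u t ∉ O := h.notMem t ⟨hc.trans htI.1.le, htI.2.le.trans hd⟩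
  have hmax : IsLocalMax (fun s => ⟪a (u t), u s - u t⟫) t := by
    filter_upwards [Ioo_mem_nhds htI.1 htI.2] with s hs
    rw [sub_self, inner_zero_right]
    exact ha.inner_sub_nonpos hut (hcontact s (Ioo_subset_Icc_self hs))
  have hder : HasDerivAt (fun s => ⟪a (u t), u s - u t⟫) ⟪a (u t), g t⟫ t :=
    ((innerSL ℝ (a (u t))).hasFDerivAt).comp_hasDerivAt t ((ht htI).sub_const (u t))
  exact hmax.hasDerivAt_eq_zero hder

/-- The vector field governing position and momentum of a minimizing curve in contact with the
obstacle. -/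
def contactField (o : E) (a : E → E) (z : E × E) : E × E :=
  (contactVelocity a z.1 z.2, -force o a z.1 (contactVelocity a z.1 z.2))

/-- The force contains the derivative of `a`; this is why the support field is required to be `C²`.
-/
theorem IsSupportField.contDiffAt_contactField (ha : IsSupportField O o a) {x : E} (hx : x ∉ O)
    (m : E) : ContDiffAt ℝ 1 (contactField o a) (x, m) := by
  have ha1 : ContDiffAt ℝ 1 (fun z : E × E => a z.1) (x, m) :=
    ContDiffAt.comp (x, m) (f := Prod.fst) ((ha.contDiffAt x hx).of_le (by norm_num)) contDiffAt_fst
  have hda : ContDiffAt ℝ 1 (fun z : E × E => fderiv ℝ a z.1) (x, m) :=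
    ContDiffAt.comp (x, m) (f := Prod.fst)
      ((ha.contDiffAt x hx).fderiv_right (by norm_num)) contDiffAt_fst
  have hv : ContDiffAt ℝ 1 (fun z : E × E => contactVelocity a z.1 z.2) (x, m) := by
    refine contDiffAt_snd.sub (ContDiffAt.smul (ContDiffAt.div (ha1.inner ℝ contDiffAt_snd)
      (ha1.norm_sq ℝ) ?_) ha1)
    simpa using ha.ne_zero hx
  refine hv.prodMk (ContDiffAt.neg (ContDiffAt.add ?_ ((hv.norm_sq ℝ).smul ha1)))
  exact ((contDiffAt_fst.sub contDiffAt_const).inner ℝ hv).smul (hda.clm_apply hv)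

/-- Uniqueness is run backwards from the right end of a contact interval, where only a left
derivative is at hand. -/
theorem IsPrimitiveOn.hasDerivWithinAt_Iic {F : Type*} [NormedAddCommGroup F] [NormedSpace ℝ F]
    [CompleteSpace F] {u g : ℝ → F} {c d : ℝ} (hu : IsPrimitiveOn u g c d)
    (hg : ContinuousOn g (Icc c d)) {t : ℝ} (ht : t ∈ Ioc c d) :
    HasDerivWithinAt u (g t) (Iic t) t := by
  have hext : Continuous (IccExtend hu.le ((Icc c d).domRestrict g)) :=
    (continuousOn_iff_continuous_domRestrict.1 hg).Icc_extend'
  have heq : ∀ s ∈ Icc c d, IccExtend hu.le ((Icc c d).domRestrict g) s = g s := fun s hs => by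
    rw [IccExtend_of_mem _ _ hs]; rfl
  have hder := (intervalIntegral.integral_hasDerivAt_right (hext.intervalIntegrable c t)
    (hext.stronglyMeasurableAtFilter _ _) hext.continuousAt).const_add (u c)
  rw [heq t ⟨ht.1.le, ht.2⟩] at hder
  refine hder.hasDerivWithinAt.congr_of_eventuallyEq ?_ ?_
  · filter_upwards [Icc_mem_nhdsLE ht.1] with s hs
    rw [hu.eq s ⟨hs.1, hs.2.trans ht.2⟩]
    congr 1
    refine intervalIntegral.integral_congr fun x hx => ?_
    rw [uIcc_of_le hs.1] at hx
    exact (heq x ⟨hx.1, hx.2.trans (hs.2.trans ht.2)⟩).symm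
  · rw [hu.eq t ⟨ht.1.le, ht.2⟩]
    congr 1
    refine intervalIntegral.integral_congr fun x hx => ?_
    rw [uIcc_of_le ht.1.le] at hx
    exact (heq x ⟨hx.1, hx.2.trans ht.2⟩).symm

theorem IsMinCurve.hasDerivWithinAt_contactField [CompleteSpace E] (ha : IsSupportField O o a)
    (h : IsMinCurve O p q u g) {M : ℝ → E}
    (hM : IsPrimitiveOn M (fun t => -force o a (u t) (g t)) 0 1)
    (hMm : ∀ᵐ t, t ∈ Ioo (0 : ℝ) 1 → momentum o a (u t) (g t) = M t)
    {c d : ℝ} (hc : 0 ≤ c) (hcd : c ≤ d) (hd : d ≤ 1)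
    (hcontact : ∀ t ∈ Icc c d, u t ∈ closure O) {t : ℝ} (ht : t ∈ Ioc c d) :
    HasDerivWithinAt (fun t => (u t, M t)) (contactField o a (u t, M t)) (Iic t) t := by
  have hsub : Icc c d ⊆ Icc 0 1 := Icc_subset_Icc hc hd
  have hg : ∀ᵐ t, t ∈ Ioo c d → g t = contactVelocity a (u t) (M t) := by
    filter_upwards [h.toIsCurve.inner_supportField_eq_zero ha hc hcd hd hcontact, hMm]
      with t h1 h2 htI
    rw [← h2 ⟨hc.trans_lt htI.1, htI.2.trans_le hd⟩, contactVelocity_momentum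
      (ha.ne_zero (h.notMem t (hsub (Ioo_subset_Icc_self htI)))) (h1 htI)]
  have hpair : ContinuousOn (fun t => contactField o a (u t, M t)) (Icc c d) := fun t ht =>
    ContinuousAt.comp_continuousWithinAt (f := fun t => (u t, M t))
      (ha.contDiffAt_contactField (h.notMem t (hsub ht)) (M t)).continuousAt
      (((h.prim.continuousOn.mono hsub) t ht).prodMk ((hM.continuousOn.mono hsub) t ht))
  have h1 : IsPrimitiveOn u (fun t => contactVelocity a (u t) (M t)) c d :=
    (h.prim.mono hc hcd hd).congr_deriv hg
  have h2 : IsPrimitiveOn M (fun t => -force o a (u t) (contactVelocity a (u t) (M t))) c d := by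
    refine (hM.mono hc hcd hd).congr_deriv ?_
    filter_upwards [hg] with t ht htI
    rw [ht htI]
  exact (h1.hasDerivWithinAt_Iic hpair.fst ht).prodMk (h2.hasDerivWithinAt_Iic hpair.snd ht)

/-- Two minimizing curves which agree from the time `s` on and both are in contact with the
obstacle shortly before `s` also agree shortly before `s`. -/
theorem IsMinCurve.exists_eqOn_of_contact [CompleteSpace E] (ha : IsSupportField O o a)
    {v h : ℝ → E} (hu : IsMinCurve O p q u g) (hv : IsMinCurve O p q v h) {c s : ℝ} (hc : 0 ≤ c)
    (hcs : c < s) (hs : s < 1) (huv : EqOn u v (Icc s 1))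
    (huc : ∀ t ∈ Icc c s, u t ∈ closure O) (hvc : ∀ t ∈ Icc c s, v t ∈ closure O) :
    ∃ r < s, EqOn u v (Icc r s) := by
  obtain ⟨M, hM, hMm⟩ := hu.exists_momentum ha
  obtain ⟨N, hN, hNm⟩ := hv.exists_momentum ha
  have hs01 : s ∈ Icc (0 : ℝ) 1 := ⟨hc.trans hcs.le, hs.le⟩
  have hs0 : 0 ≤ s := hs01.1
  have huvs : u s = v s := huv (left_mem_Icc.2 hs.le)
  -- After `s` the curves have the same position and velocity, hence the same momentum; continuity
  -- of the momenta carries this to `s`, although the velocities themselves need not be continuous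
  -- there.
  have hMN : M s = N s := by
    have hae : ∀ᵐ t, t ∈ Ioo s 1 → M t = N t := by
      filter_upwards [hMm, hNm, (hu.prim.mono hs0 hs.le le_rfl).ae_eq_deriv
        (hv.prim.mono hs0 hs.le le_rfl) huv] with t h1 h2 h3 ht
      have ht0 : t ∈ Ioo (0 : ℝ) 1 := ⟨hs0.trans_lt ht.1, ht.2⟩
      rw [← h1 ht0, ← h2 ht0, h3 ht, huv (Ioo_subset_Icc_self ht)]
    have hcM : ContinuousOn M (Icc s 1) := hM.continuousOn.mono (Icc_subset_Icc hs0 le_rfl)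
    have hcN : ContinuousOn N (Icc s 1) := hN.continuousOn.mono (Icc_subset_Icc hs0 le_rfl)
    have h1 : EqOn M N (Ioo s 1) := Measure.eqOn_open_of_ae_eq (μ := volume)
      ((ae_restrict_iff' measurableSet_Ioo).2 hae) isOpen_Ioo
      (hcM.mono Ioo_subset_Icc_self) (hcN.mono Ioo_subset_Icc_self)
    exact h1.of_subset_closure hcM hcN Ioo_subset_Icc_self (by rw [closure_Ioo hs.ne])
      (left_mem_Icc.2 hs.le)
  obtain ⟨K, V, hV, hL⟩ :=
    (ha.contDiffAt_contactField (hu.notMem s hs01) (M s)).exists_lipschitzOnWith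
  have hcont : ∀ {w W : ℝ → E}, ContinuousOn w (Icc 0 1) → ContinuousOn W (Icc 0 1) →
      (w s, W s) = (u s, M s) → ∀ᶠ t in 𝓝[≤] s, (w t, W t) ∈ V := by
    intro w W hw hW he
    have h1 : ContinuousWithinAt (fun t => (w t, W t)) (Icc 0 1) s := (hw s hs01).prodMk (hW s hs01)
    have h2 : Icc 0 s ∈ 𝓝[≤] s := Icc_mem_nhdsLE (hc.trans_lt hcs)
    have h3 : Tendsto (fun t => (w t, W t)) (𝓝[≤] s) (𝓝 (u s, M s)) := by
      rw [← he]
      exact h1.tendsto.mono_left (nhdsWithin_le_of_mem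
        (mem_of_superset h2 (Icc_subset_Icc le_rfl hs.le)))
    exact h3 hV
  have hev := (hcont hu.prim.continuousOn hM.continuousOn rfl).and
    (hcont hv.prim.continuousOn hN.continuousOn (by rw [huvs, hMN]))
  obtain ⟨r', hr', hr'V⟩ := (mem_nhdsLE_iff_exists_Icc_subset).1 hev
  refine ⟨max c r', max_lt hcs hr', ?_⟩
  have hcr : c ≤ max c r' := le_max_left _ _
  have hrs : max c r' ≤ s := (max_lt hcs hr').le
  have hsub : Icc (max c r') s ⊆ Icc 0 1 := Icc_subset_Icc (hc.trans hcr) hs.le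
  have hmem : ∀ t ∈ Ioc (max c r') s, t ∈ Ioc c s := fun t ht => ⟨hcr.trans_lt ht.1, ht.2⟩
  have hmem' : ∀ t ∈ Ioc (max c r') s, t ∈ Icc r' s :=
    fun t ht => ⟨(le_max_right _ _).trans ht.1.le, ht.2⟩
  have key := ODE_solution_unique_of_mem_Icc_left (v := fun _ => contactField o a) (s := fun _ => V)
    (K := K) (f := fun t => (u t, M t)) (g := fun t => (v t, N t)) (a := max c r') (b := s)
    (fun _ _ => hL) ((hu.prim.continuousOn.mono hsub).prodMk (hM.continuousOn.mono hsub))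
    (fun t ht => hu.hasDerivWithinAt_contactField ha hM hMm hc hcs.le hs.le huc (hmem t ht))
    (fun t ht => (hr'V (hmem' t ht)).1)
    ((hv.prim.continuousOn.mono hsub).prodMk (hN.continuousOn.mono hsub))
    (fun t ht => hv.hasDerivWithinAt_contactField ha hN hNm hc hcs.le hs.le hvc (hmem t ht))
    (fun t ht => (hr'V (hmem' t ht)).2) (by simp only [huvs, hMN])
  exact fun t ht => congrArg Prod.fst (key ht)

end Momentum

/-! ### Backward uniqueness of minimizers. -/

section Uniqueness

variable {E : Type*} [NormedAddCommGroup E] [InnerProductSpace ℝ E] [CompleteSpace E] {O : Set E}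
  {p q o : E} {a : E → E} {u g v h : ℝ → E}

/-- Both total energies and both tail energies agree, so `v` has on `[0, s]` the energy of the
affine curve `u` with the same endpoints. -/
theorem IsMinCurve.eqOn_of_isAffineOn (hu : IsMinCurve O p q u g) (hv : IsMinCurve O p q v h)
    {s : ℝ} (hs0 : 0 ≤ s) (hs1 : s ≤ 1) (huv : EqOn u v (Icc s 1)) {k : E}
    (hk : IsAffineOn u k 0 s) : EqOn u v (Icc 0 s) := by
  have hE := le_antisymm (hu.le _ _ hv.toIsCurve) (hv.le _ _ hu.toIsCurve)
  have hsplit : ∀ {w f : ℝ → E}, IsMinCurve O p q w f →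
      (∫ t in (0 : ℝ)..s, ‖f t‖ ^ 2) + ∫ t in s..1, ‖f t‖ ^ 2 = ∫ t in (0 : ℝ)..1, ‖f t‖ ^ 2 :=
    fun hw => intervalIntegral.integral_add_adjacent_intervals
      (intervalIntegrable_norm_sq hs0 (memLp_restrict_mono hw.memLp le_rfl hs1))
      (intervalIntegrable_norm_sq hs1 (memLp_restrict_mono hw.memLp hs0 le_rfl))
  have htail : ∫ t in s..1, ‖g t‖ ^ 2 = ∫ t in s..1, ‖h t‖ ^ 2 := by
    refine intervalIntegral.integral_congr_ae ?_
    have h₂ : ∀ᵐ x : ℝ, x ≠ 1 := by simp [ae_iff, measure_singleton]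
    filter_upwards [(hu.prim.mono hs0 hs1 le_rfl).ae_eq_deriv (hv.prim.mono hs0 hs1 le_rfl) huv,
      h₂] with t h3 h4 h5
    rw [uIoc_of_le hs1] at h5
    rw [h3 ⟨h5.1, lt_of_le_of_ne h5.2 h4⟩]
  have hpu := hu.prim.mono le_rfl hs0 hs1
  have hpv := hv.prim.mono le_rfl hs0 hs1
  have he := hpu.energy_of_isAffineOn hk
  have h0 : u 0 = v 0 := hu.zero.trans hv.zero.symm
  have hs : u s = v s := huv (left_mem_Icc.2 hs1)
  have hva := hpv.isAffineOn_of_energy_le (memLp_restrict_mono hv.memLp le_rfl hs1) (k := k)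
    (by rw [← hs, ← h0]; exact hk s (right_mem_Icc.2 hs0))
    (by linarith [hsplit hu, hsplit hv])
  exact fun t ht => by rw [hk t ht, hva t ht, h0]

/-- Two minimizing curves which agree from the time `s` on and do not touch the obstacle at that
time also agree shortly before `s`. -/
theorem IsMinCurve.exists_eqOn_of_notMem_closure (hu : IsMinCurve O p q u g)
    (hv : IsMinCurve O p q v h) {s : ℝ} (hs : s ∈ Ioo (0 : ℝ) 1) (huv : EqOn u v (Icc s 1))
    (hus : u s ∉ closure O) : ∃ r < s, EqOn u v (Icc r s) := by
  have hnhds : Icc (0 : ℝ) 1 ∈ 𝓝 s := Icc_mem_nhds hs.1 hs.2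
  have hvs : v s ∉ closure O := by rwa [← huv (left_mem_Icc.2 hs.2.le)]
  have hopen : IsOpen (closure O)ᶜ := isClosed_closure.isOpen_compl
  have hev := ((hu.prim.continuousOn.continuousAt hnhds).eventually (hopen.mem_nhds hus)).and
    (((hv.prim.continuousOn.continuousAt hnhds).eventually (hopen.mem_nhds hvs)).and hnhds)
  obtain ⟨ε, hε, hball⟩ := Metric.eventually_nhds_iff_ball.1 hev
  have hmem : ∀ t ∈ Icc (s - ε / 2) (s + ε / 2), t ∈ Metric.ball s ε := fun t ht => by
    rw [Metric.mem_ball, Real.dist_eq, abs_lt]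
    constructor <;> linarith [ht.1, ht.2]
  have hc : 0 ≤ s - ε / 2 := (hball _ (hmem _ (left_mem_Icc.2 (by linarith)))).2.2.1
  have hd : s + ε / 2 ≤ 1 := (hball _ (hmem _ (right_mem_Icc.2 (by linarith)))).2.2.2
  obtain ⟨k, hk⟩ := hu.exists_isAffineOn hc (by linarith) hd fun t ht =>
    (hball t (hmem t (Ioo_subset_Icc_self ht))).1
  obtain ⟨l, hl⟩ := hv.exists_isAffineOn hc (by linarith) hd fun t ht =>
    (hball t (hmem t (Ioo_subset_Icc_self ht))).2.1
  have e1 := huv (left_mem_Icc.2 hs.2.le)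
  have e2 := huv (show s + ε / 2 ∈ Icc s 1 from ⟨by linarith, hd⟩)
  rw [hk s ⟨by linarith, by linarith⟩, hl s ⟨by linarith, by linarith⟩] at e1
  rw [hk _ (right_mem_Icc.2 (by linarith)), hl _ (right_mem_Icc.2 (by linarith))] at e2
  have e3 : (ε / 2) • k = (ε / 2) • l := by
    have e4 := congrArg₂ (· - ·) e2 e1
    simp only [add_sub_add_left_eq_sub, ← sub_smul] at e4
    convert e4 using 2 <;> ring
  have hkl : k = l := smul_right_injective E (by positivity : ε / 2 ≠ 0) e3
  subst hkl
  refine ⟨s - ε / 2, by linarith, fun t ht => ?_⟩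
  have ht' : t ∈ Icc (s - ε / 2) (s + ε / 2) := ⟨ht.1, by linarith [ht.2]⟩
  rw [hk t ht', hl t ht', add_right_cancel e1]

/-- Minimizing curves which agree on a final time interval are equal. -/
theorem IsMinCurve.eqOn_of_eqOn_final (hO : Convex ℝ O) (ha : IsSupportField O o a)
    (hu : IsMinCurve O p q u g) (hv : IsMinCurve O p q v h) {s₀ : ℝ} (hs₀ : s₀ ∈ Ico (0 : ℝ) 1)
    (huv : EqOn u v (Icc s₀ 1)) : EqOn u v (Icc 0 1) := by
  set S : Set ℝ := {s | s ∈ Icc (0 : ℝ) 1 ∧ EqOn u v (Icc s 1)}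
  have hS₀ : s₀ ∈ S := ⟨Ico_subset_Icc_self hs₀, huv⟩
  have hbdd : BddBelow S := ⟨0, fun s hs => hs.1.1⟩
  set s := sInf S with hsdef
  have hs0 : 0 ≤ s := le_csInf ⟨s₀, hS₀⟩ fun r hr => hr.1.1
  have hs1 : s < 1 := (csInf_le hbdd hS₀).trans_lt hs₀.2
  have hsub : Icc s 1 ⊆ Icc 0 1 := Icc_subset_Icc hs0 le_rfl
  have heq : EqOn u v (Icc s 1) := by
    have h1 : EqOn u v (Ioo s 1) := fun t ht => by
      obtain ⟨r, hr, hrt⟩ := exists_lt_of_csInf_lt ⟨s₀, hS₀⟩ ht.1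
      exact hr.2 ⟨hrt.le, ht.2.le⟩
    exact h1.of_subset_closure (hu.prim.continuousOn.mono hsub) (hv.prim.continuousOn.mono hsub)
      Ioo_subset_Icc_self (by rw [closure_Ioo hs1.ne])
  rcases hs0.eq_or_lt with h0 | hpos
  · rwa [← h0] at heq
  exfalso
  obtain ⟨r, hrs, hr⟩ : ∃ r < s, EqOn u v (Icc r s) := by
    by_cases hus : u s ∈ closure O
    -- If both curves have earlier contacts, they are in contact on a common interval ending at `s`
    -- and the ODE applies. Otherwise one of them is affine on `[0, s]`, and comparing energies
    -- settles all of `[0, s]` at once.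
    · by_cases hcu : ∃ c ∈ Ioo 0 s, u c ∈ closure O
      · by_cases hcv : ∃ c ∈ Ioo 0 s, v c ∈ closure O
        · obtain ⟨c, hc, huc⟩ := hcu
          obtain ⟨d, hd, hvd⟩ := hcv
          have hvs : v s ∈ closure O := by rwa [← heq (left_mem_Icc.2 hs1.le)]
          refine hu.exists_eqOn_of_contact ha hv (c := max c d) (hc.1.le.trans (le_max_left _ _))
            (max_lt hc.2 hd.2) hs1 heq (fun t ht => ?_) (fun t ht => ?_)
          · exact hu.mem_closure_of_mem_Icc hO hc.1.le hs1.le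
              ⟨(le_max_left _ _).trans ht.1, ht.2⟩ huc hus
          · exact hv.mem_closure_of_mem_Icc hO hd.1.le hs1.le
              ⟨(le_max_right _ _).trans ht.1, ht.2⟩ hvd hvs
        · push Not at hcv
          obtain ⟨k, hk⟩ := hv.exists_isAffineOn le_rfl hpos hs1.le hcv
          exact ⟨0, hpos, (hv.eqOn_of_isAffineOn hu hs0 hs1.le heq.symm hk).symm⟩
      · push Not at hcu
        obtain ⟨k, hk⟩ := hu.exists_isAffineOn le_rfl hpos hs1.le hcu
        exact ⟨0, hpos, hu.eqOn_of_isAffineOn hv hs0 hs1.le heq hk⟩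
    · exact hu.exists_eqOn_of_notMem_closure hv ⟨hpos, hs1⟩ heq hus
  have hmem : max r 0 ∈ S := by
    refine ⟨⟨le_max_right _ _, (max_lt hrs hpos).le.trans hs1.le⟩, fun t ht => ?_⟩
    rcases le_total t s with hts | hst
    · exact hr ⟨(le_max_left _ _).trans ht.1, hts⟩
    · exact heq ⟨hst, ht.2⟩
  exact absurd (csInf_le hbdd hmem) (not_le.2 (max_lt hrs hpos))

end Uniqueness

/-! ### Restricting and concatenating minimizers. -/

section Concatenation

theorem memLp_of_intervalIntegrable {F : Type*} [NormedAddCommGroup F] {g : ℝ → F} {c d : ℝ}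
    (hcd : c ≤ d) (hg : IntervalIntegrable g volume c d)
    (hg2 : IntervalIntegrable (fun t => ‖g t‖ ^ 2) volume c d) :
    MemLp g 2 (volume.restrict (Icc c d)) := by
  rw [intervalIntegrable_iff_integrableOn_Icc_of_le hcd] at hg hg2
  exact (memLp_two_iff_integrable_sq_norm hg.1).2 hg2

variable {F : Type*} [NormedAddCommGroup F] [NormedSpace ℝ F] {u g v h : ℝ → F} {c d : ℝ}

theorem IsPrimitiveOn.congr (hu : IsPrimitiveOn u g c d) (huv : EqOn u v (Icc c d)) :
    IsPrimitiveOn v g c d :=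
  ⟨hu.le, hu.integrable, fun t ht => by
    rw [← huv ht, ← huv (left_mem_Icc.2 hu.le)]; exact hu.eq t ht⟩

theorem IsPrimitiveOn.comp_mul_left {r : ℝ} (hr : 0 < r) (hcd : c ≤ d)
    (hu : IsPrimitiveOn u g (r * c) (r * d)) :
    IsPrimitiveOn (fun t => u (r * t)) (fun t => r • g (r * t)) c d where
  le := hcd
  integrable := by
    have := (hu.integrable.comp_mul_left (c := r)).smul r
    rwa [mul_div_cancel_left₀ _ hr.ne', mul_div_cancel_left₀ _ hr.ne'] at this
  eq t ht := by
    rw [intervalIntegral.integral_smul, intervalIntegral.smul_integral_comp_mul_left]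
    exact hu.eq _ ⟨mul_le_mul_of_nonneg_left ht.1 hr.le, mul_le_mul_of_nonneg_left ht.2 hr.le⟩

theorem IsPrimitiveOn.trans {e : ℝ} (h₁ : IsPrimitiveOn u g c d) (h₂ : IsPrimitiveOn u g d e) :
    IsPrimitiveOn u g c e where
  le := h₁.le.trans h₂.le
  integrable := h₁.integrable.trans h₂.integrable
  eq t ht := by
    rcases le_total t d with htd | hdt
    · exact h₁.eq t ⟨ht.1, htd⟩
    · rw [h₂.eq t ⟨hdt, ht.2⟩, h₁.eq d (right_mem_Icc.2 h₁.le), add_assoc,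
        intervalIntegral.integral_add_adjacent_intervals h₁.integrable
          (h₂.integrable_of_mem (left_mem_Icc.2 h₂.le) ⟨hdt, ht.2⟩)]

theorem integral_norm_smul_comp_mul_left_sq {r : ℝ} (hr : r ≠ 0) :
    ∫ t in c..d, ‖r • g (r * t)‖ ^ 2 = r * ∫ t in r * c..r * d, ‖g t‖ ^ 2 := by
  simp only [norm_smul, mul_pow, Real.norm_eq_abs, sq_abs]
  rw [intervalIntegral.integral_const_mul,
    intervalIntegral.integral_comp_mul_left (fun t => ‖g t‖ ^ 2) hr, smul_eq_mul]
  field_simp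

theorem intervalIntegrable_norm_smul_comp_mul_left_sq {r : ℝ} (hr : r ≠ 0)
    (hg : IntervalIntegrable (fun t => ‖g t‖ ^ 2) volume (r * c) (r * d)) :
    IntervalIntegrable (fun t => ‖r • g (r * t)‖ ^ 2) volume c d := by
  simp only [norm_smul, mul_pow]
  have := (hg.comp_mul_left (c := r)).const_mul (‖r‖ ^ 2)
  rwa [mul_div_cancel_left₀ _ hr, mul_div_cancel_left₀ _ hr] at this

variable {E : Type*} [NormedAddCommGroup E] [InnerProductSpace ℝ E] {O : Set E}
  {p p' q x o : E} {a : E → E}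

theorem IsCurve.restrict {u g : ℝ → E} (hu : IsCurve O p q u g) {s : ℝ} (hs : s ∈ Ioc (0 : ℝ) 1) :
    IsCurve O p (u s) (fun t => u (s * t)) (fun t => s • g (s * t)) := by
  have hp : IsPrimitiveOn u g (s * 0) (s * 1) := by
    rw [mul_zero, mul_one]; exact hu.prim.mono le_rfl hs.1.le hs.2
  have hp' := hp.comp_mul_left hs.1 zero_le_one
  refine ⟨hp', memLp_of_intervalIntegrable zero_le_one hp'.integrable
    (intervalIntegrable_norm_smul_comp_mul_left_sq hs.1.ne' ?_), by simp [hu.zero], by simp,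
    fun t ht => hu.notMem _ ⟨mul_nonneg hs.1.le ht.1, mul_le_one₀ hs.2 ht.1 ht.2⟩⟩
  exact intervalIntegrable_norm_sq hp.le
    (memLp_restrict_mono hu.memLp (by simp) (by simpa using hs.2))

/-- The curve `v`, run through up to the time `s`, followed by `u`. -/
def concat (s : ℝ) (v u : ℝ → E) (t : ℝ) : E := if t ≤ s then v (s⁻¹ * t) else u t

/-- Running through `v` in time `s` multiplies its energy by `s⁻¹`. Only the part of `u` after `s`
is used, so its initial point `p'` is arbitrary. -/
theorem IsCurve.concat {u g v h : ℝ → E} (hv : IsCurve O p x v h) (hu : IsCurve O p' q u g) {s : ℝ}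
    (hs : s ∈ Ioo (0 : ℝ) 1) (hx : u s = x) :
    IsCurve O p q (concat s v u) (concat s (fun t => s⁻¹ • h t) g) ∧
      ∫ t in (0 : ℝ)..1, ‖Obstacle.concat s (fun t => s⁻¹ • h t) g t‖ ^ 2 =
        s⁻¹ * (∫ t in (0 : ℝ)..1, ‖h t‖ ^ 2) + ∫ t in s..1, ‖g t‖ ^ 2 := by
  have hi : 0 < s⁻¹ := inv_pos.2 hs.1
  have hs1 : s⁻¹ * s = 1 := inv_mul_cancel₀ hs.1.ne'
  have hpv : IsPrimitiveOn v h (s⁻¹ * 0) (s⁻¹ * s) := by rw [mul_zero, hs1]; exact hv.prim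
  have hleft := hpv.comp_mul_left hi hs.1.le
  have hright := hu.prim.mono hs.1.le hs.2.le le_rfl
  have el : ∀ t ∈ Ioc 0 s, s⁻¹ • h (s⁻¹ * t) = Obstacle.concat s (fun t => s⁻¹ • h t) g t :=
    fun t ht => by rw [Obstacle.concat, if_pos ht.2]
  have er : ∀ t ∈ Ioc s 1, g t = Obstacle.concat s (fun t => s⁻¹ • h t) g t :=
    fun t ht => by rw [Obstacle.concat, if_neg (not_le.2 ht.1)]
  have hl : IsPrimitiveOn (Obstacle.concat s v u) (Obstacle.concat s (fun t => s⁻¹ • h t) g) 0 s :=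
    (hleft.congr fun t ht => by simp only [Obstacle.concat, if_pos ht.2]).congr_deriv
      (Eventually.of_forall fun t ht => el t (Ioo_subset_Ioc_self ht))
  have hr : IsPrimitiveOn (Obstacle.concat s v u) (Obstacle.concat s (fun t => s⁻¹ • h t) g) s 1 :=
    (hright.congr fun t ht => by
      rcases ht.1.eq_or_lt with e | hlt
      · rw [Obstacle.concat, if_pos e.ge, ← e, hs1, hx, hv.one]
      · rw [Obstacle.concat, if_neg (not_le.2 hlt)]).congr_deriv
      (Eventually.of_forall fun t ht => er t (Ioo_subset_Ioc_self ht))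
  have hp := hl.trans hr
  have hil : IntervalIntegrable (fun t => ‖Obstacle.concat s (fun t => s⁻¹ • h t) g t‖ ^ 2)
      volume 0 s := by
    have hsq : IntervalIntegrable (fun t => ‖h t‖ ^ 2) volume (s⁻¹ * 0) (s⁻¹ * s) := by
      rw [mul_zero, hs1]; exact intervalIntegrable_norm_sq zero_le_one hv.memLp
    refine (intervalIntegrable_norm_smul_comp_mul_left_sq hi.ne' hsq).congr fun t ht => ?_
    rw [uIoc_of_le hs.1.le] at ht
    simp only [el t ht]
  have hir : IntervalIntegrable (fun t => ‖Obstacle.concat s (fun t => s⁻¹ • h t) g t‖ ^ 2)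
      volume s 1 := by
    refine (intervalIntegrable_norm_sq hs.2.le (memLp_restrict_mono hu.memLp hs.1.le
      le_rfl)).congr fun t ht => ?_
    rw [uIoc_of_le hs.2.le] at ht
    simp only [er t ht]
  refine ⟨⟨hp, memLp_of_intervalIntegrable zero_le_one hp.integrable (hil.trans hir), ?_, ?_,
    fun t ht => ?_⟩, ?_⟩
  · rw [Obstacle.concat, if_pos hs.1.le, mul_zero, hv.zero]
  · rw [Obstacle.concat, if_neg (not_le.2 hs.2), hu.one]
  · by_cases hts : t ≤ s
    · rw [Obstacle.concat, if_pos hts]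
      refine hv.notMem _ ⟨mul_nonneg hi.le ht.1, ?_⟩
      rw [← hs1]
      exact mul_le_mul_of_nonneg_left hts hi.le
    · rw [Obstacle.concat, if_neg hts]
      exact hu.notMem t ht
  · rw [← intervalIntegral.integral_add_adjacent_intervals hil hir]
    congr 1
    · rw [show (∫ t in (0 : ℝ)..1, ‖h t‖ ^ 2) = ∫ t in s⁻¹ * 0..s⁻¹ * s, ‖h t‖ ^ 2 by
        rw [mul_zero, hs1], ← integral_norm_smul_comp_mul_left_sq hi.ne']
      refine intervalIntegral.integral_congr_ae (Eventually.of_forall fun t ht => ?_)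
      rw [uIoc_of_le hs.1.le] at ht
      rw [el t ht]
    · refine intervalIntegral.integral_congr_ae (Eventually.of_forall fun t ht => ?_)
      rw [uIoc_of_le hs.2.le] at ht
      rw [er t ht]

variable {u g : ℝ → E}

theorem IsCurve.integral_restrict (hu : IsCurve O p q u g) {s : ℝ} (hs : s ∈ Ioo (0 : ℝ) 1) :
    s⁻¹ * (∫ t in (0 : ℝ)..1, ‖s • g (s * t)‖ ^ 2) + ∫ t in s..1, ‖g t‖ ^ 2 =
      ∫ t in (0 : ℝ)..1, ‖g t‖ ^ 2 := by
  rw [integral_norm_smul_comp_mul_left_sq hs.1.ne', inv_mul_cancel_left₀ hs.1.ne', mul_zero,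
    mul_one]
  exact intervalIntegral.integral_add_adjacent_intervals
    (intervalIntegrable_norm_sq hs.1.le (memLp_restrict_mono hu.memLp le_rfl hs.2.le))
    (intervalIntegrable_norm_sq hs.2.le (memLp_restrict_mono hu.memLp hs.1.le le_rfl))

/-- A better curve to `u s`, followed by the rest of `u`, would beat `u`. -/
theorem IsMinCurve.restrict (hu : IsMinCurve O p q u g) {s : ℝ} (hs : s ∈ Ioo (0 : ℝ) 1) :
    IsMinCurve O p (u s) (fun t => u (s * t)) (fun t => s • g (s * t)) := by
  refine ⟨hu.toIsCurve.restrict (Ioo_subset_Ioc_self hs), fun v h hv => ?_⟩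
  have h1 := hv.concat hu.toIsCurve hs rfl
  have h2 := hu.le _ _ h1.1
  rw [h1.2, ← hu.toIsCurve.integral_restrict hs] at h2
  exact le_of_mul_le_mul_left (le_of_add_le_add_right h2) (inv_pos.2 hs.1)

/-- Replacing the initial part of `u` by `v` gives another minimizer to `q`, which agrees with `u`
from `s` on; backward uniqueness identifies the two. -/
theorem IsMinCurve.eqOn_restrict [CompleteSpace E] (hO : Convex ℝ O) (ha : IsSupportField O o a)
    (hu : IsMinCurve O p q u g) {s : ℝ} (hs : s ∈ Ioo (0 : ℝ) 1) {v h : ℝ → E}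
    (hv : IsMinCurve O p (u s) v h) : EqOn v (fun t => u (s * t)) (Icc 0 1) := by
  have h1 := hv.toIsCurve.concat hu.toIsCurve hs rfl
  have hw : IsMinCurve O p q (Obstacle.concat s v u)
      (Obstacle.concat s (fun t => s⁻¹ • h t) g) := by
    refine ⟨h1.1, fun w f hwf => le_trans ?_ (hu.le w f hwf)⟩
    rw [h1.2, ← hu.toIsCurve.integral_restrict hs]
    gcongr
    · exact (inv_pos.2 hs.1).le
    · exact hv.le _ _ (hu.restrict hs).toIsCurve
  have hs1 : s⁻¹ * s = 1 := inv_mul_cancel₀ hs.1.ne'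
  have key := hw.eqOn_of_eqOn_final hO ha hu (s₀ := s) (Ioo_subset_Ico_self hs) (fun t ht => by
    rcases ht.1.eq_or_lt with e | hlt
    · rw [Obstacle.concat, if_pos e.ge, ← e, hs1, hv.one]
    · rw [Obstacle.concat, if_neg (not_le.2 hlt)])
  intro t ht
  have hst : s * t ≤ s := mul_le_of_le_one_right hs.1.le ht.2
  have := key (show s * t ∈ Icc (0 : ℝ) 1 from ⟨mul_nonneg hs.1.le ht.1, hst.trans hs.2.le⟩)
  rwa [Obstacle.concat, if_pos hst, ← mul_assoc, hs1, one_mul] at this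

theorem IsMinCurve.mem_uniqueSet [CompleteSpace E] (hO : Convex ℝ O) (ha : IsSupportField O o a)
    (hu : IsMinCurve O p q u g) {s : ℝ} (hs : s ∈ Ioo (0 : ℝ) 1) (hus : u s ∉ closure O) :
    u s ∈ uniqueSet O p := by
  obtain ⟨U, hU, -⟩ := (hu.restrict hs).exists_H1
  refine ⟨hus, U, hU, fun V hV => H1.ext_path ?_⟩
  exact (hu.eqOn_restrict hO ha hs (V.isMinCurve_iff.2 hV)).trans
    (hu.eqOn_restrict hO ha hs (U.isMinCurve_iff.2 hU)).symm

end Concatenation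

/-! ### Last contact point and conclusion. -/

section Main

theorem disjoint_uniqueSet_nonuniqueSet {E : Type*} [NormedAddCommGroup E]
    [InnerProductSpace ℝ E] {O : Set E} {p : E} :
    Disjoint (uniqueSet O p) (nonuniqueSet O p) := by
  rw [Set.disjoint_left]
  rintro q ⟨-, hu⟩ ⟨-, U, V, hU, hV, hne⟩
  exact hne (hu.unique hU hV)

variable {E : Type*} [NormedAddCommGroup E] [InnerProductSpace ℝ E] [CompleteSpace E] {O : Set E}
  {p q : E}

/-- A contact-free minimizer would be the straight segment from `p` to `q`, which meets `O`. -/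
theorem IsMinCurve.exists_mem_closure {u g : ℝ → E} (hu : IsMinCurve O p q u g)
    (hseg : (segment ℝ p q ∩ O).Nonempty) : ∃ t ∈ Icc (0 : ℝ) 1, u t ∈ closure O := by
  by_contra! hfree
  obtain ⟨k, hk⟩ := hu.exists_isAffineOn le_rfl zero_lt_one le_rfl fun t ht =>
    hfree t (Ioo_subset_Icc_self ht)
  obtain ⟨x, hx, hxO⟩ := hseg
  rw [segment_eq_image'] at hx
  obtain ⟨t, ht, rfl⟩ := hx
  have h1 := hk 1 (right_mem_Icc.2 zero_le_one)
  rw [hu.one, hu.zero, sub_zero, one_smul] at h1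
  have h2 := hk t ht
  rw [hu.zero, sub_zero] at h2
  refine hu.notMem t ht ?_
  rwa [h2, show k = q - p by rw [h1, add_sub_cancel_left]]

theorem IsMinimizer.exists_isGreatest_contact (hO : IsSmoothConvexObstacle O) (hq : q ∉ closure O)
    (hseg : (segment ℝ p q ∩ O).Nonempty) {U : H1 E} (hU : IsMinimizer O p q U) :
    ∃ b : I, IsGreatest {t : I | U t ∈ frontier O} b ∧
      ∀ q' ∈ openSegment ℝ (U b) q, q' ∈ uniqueSet O p := by
  obtain ⟨o, a, ha⟩ := hO.exists_isSupportField
  have hu := U.isMinCurve_iff.2 hU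
  have hfr : ∀ t : I, U t ∈ frontier O ↔ U t ∈ closure O := fun t => by
    rw [hO.isOpen.frontier_eq]
    exact ⟨fun h => h.1, fun h => ⟨h, hU.1.2.2 t⟩⟩
  obtain ⟨t₀, ht₀, ht₀O⟩ := hu.exists_mem_closure hseg
  have hcl : IsClosed {t : I | U t ∈ frontier O} :=
    isClosed_frontier.preimage U.toFun.continuous
  obtain ⟨b, hb⟩ := hcl.isCompact.exists_isGreatest ⟨⟨t₀, ht₀⟩, by
    rw [mem_ofPred_eq, hfr, ← U.path_of_mem ht₀]; exact ht₀O⟩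
  refine ⟨b, hb, fun q' hq' => ?_⟩
  have hbcl : U b ∈ closure O := (hfr b).1 hb.1
  have hb1 : (b : ℝ) < 1 := by
    refine lt_of_le_of_ne b.2.2 fun e => hq ?_
    have : b = 1 := Subtype.ext e
    rwa [this, hU.1.2.1] at hbcl
  have hfree : ∀ t ∈ Icc (0 : ℝ) 1, (b : ℝ) < t → U.path t ∉ closure O := fun t ht hbt hO' => by
    rw [U.path_of_mem ht, ← hfr] at hO'
    exact not_le.2 hbt (hb.2 hO')
  obtain ⟨k, hk⟩ := hu.exists_isAffineOn b.2.1 hb1 le_rfl fun t ht =>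
    hfree t ⟨b.2.1.trans ht.1.le, ht.2.le⟩ ht.1
  rw [openSegment_eq_image'] at hq'
  obtain ⟨θ, hθ, rfl⟩ := hq'
  -- On `[b, 1]` the curve is affine, so the point at parameter `θ` of the last segment is its
  -- position at this time.
  set s : ℝ := b + θ * (1 - b) with hs
  have hbs : (b : ℝ) < s := by nlinarith [hθ.1]
  have hs1 : s < 1 := by nlinarith [hθ.2]
  have hs01 : s ∈ Ioo (0 : ℝ) 1 := ⟨b.2.1.trans_lt hbs, hs1⟩
  have heq : U b + θ • (q - U b) = U.path s := by
    have h1 := hk 1 (right_mem_Icc.2 hb1.le)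
    rw [hu.one, U.path_coe] at h1
    rw [hk s ⟨hbs.le, hs1.le⟩, U.path_coe, h1, add_sub_cancel_left, smul_smul, hs,
      add_sub_cancel_left]
  rw [show (fun θ : ℝ => U b + θ • (q - U b)) θ = U.path s from heq]
  exact hu.mem_uniqueSet hO.convex ha hs01 (hfree s (Ioo_subset_Icc_self hs01) hbs)

/-- If the segment avoids `O`, it is itself admissible, and any minimizer, having no larger energy,
coincides with it. -/
theorem segment_inter_nonempty_of_ne {U V : H1 E} (hU : IsMinimizer O p q U)
    (hV : IsMinimizer O p q V) (hne : U ≠ V) : (segment ℝ p q ∩ O).Nonempty := by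
  by_contra hempty
  have hprim : IsPrimitiveOn (fun t : ℝ => p + t • (q - p)) (fun _ => q - p) 0 1 :=
    ⟨zero_le_one, intervalIntegrable_const, fun t _ => by
      rw [intervalIntegral.integral_const]; simp⟩
  have hcurve : IsCurve O p q (fun t : ℝ => p + t • (q - p)) (fun _ => q - p) :=
    ⟨hprim, memLp_of_continuousOn continuousOn_const, by simp, by simp, fun t ht hO =>
      hempty ⟨_, by rw [segment_eq_image']; exact ⟨t, ht, rfl⟩, hO⟩⟩
  have haff : ∀ {W : H1 E}, IsMinimizer O p q W → IsAffineOn W.path (q - p) 0 1 := fun hW => by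
    have hw := (H1.isMinCurve_iff _).2 hW
    refine hw.prim.isAffineOn_of_energy_le hw.memLp (by simp [hw.zero, hw.one]) ?_
    refine (hw.le _ _ hcurve).trans ?_
    rw [intervalIntegral.integral_const, smul_eq_mul]
  refine hne (H1.ext_path fun t ht => ?_)
  rw [haff hU t ht, haff hV t ht, ((H1.isMinCurve_iff _).2 hU).zero,
    ((H1.isMinCurve_iff _).2 hV).zero]

/-- The point `q` is an endpoint of an open segment of points with unique minimizers, but is not
itself such a point. -/
theorem nonuniqueSet_subset_frontier (hO : IsSmoothConvexObstacle O) :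
    nonuniqueSet O p ⊆ frontier (uniqueSet O p) := by
  intro q hq
  refine ⟨?_, fun hint => Set.disjoint_left.1 disjoint_uniqueSet_nonuniqueSet
    (interior_subset hint) hq⟩
  obtain ⟨hqO, U, V, hU, hV, hne⟩ := hq
  obtain ⟨b, -, hb⟩ := hU.exists_isGreatest_contact hO hqO (segment_inter_nonempty_of_ne hU hV hne)
  exact closure_mono (fun q' hq' => hb q' hq')
    (segment_subset_closure_openSegment (right_mem_segment ℝ (U b) q))

theorem interior_nonuniqueSet (hO : IsSmoothConvexObstacle O) :
    interior (nonuniqueSet O p) = ∅ := by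
  rw [Set.eq_empty_iff_forall_notMem]
  intro q hq
  have hcl : q ∈ closure (uniqueSet O p) :=
    (nonuniqueSet_subset_frontier hO (interior_subset hq)).1
  obtain ⟨x, hx, hx'⟩ := mem_closure_iff.1 hcl _ isOpen_interior hq
  exact Set.disjoint_left.1 disjoint_uniqueSet_nonuniqueSet hx' (interior_subset hx)

end Main

end Obstacle

end

theorem theorem1p2 {n : ℕ} (O : Set (EuclideanSpace ℝ (Fin n)))
    (hO : Obstacle.IsSmoothConvexObstacle O)
    (p : EuclideanSpace ℝ (Fin n)) (hp : p ∉ closure O) :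
    Obstacle.nonuniqueSet O p ⊆ frontier (Obstacle.uniqueSet O p) ∧
    interior (Obstacle.nonuniqueSet O p) = ∅ ∧
    ∀ q : EuclideanSpace ℝ (Fin n), q ∉ closure O → (segment ℝ p q ∩ O).Nonempty →
      ∀ u : Obstacle.H1 (EuclideanSpace ℝ (Fin n)), Obstacle.IsMinimizer O p q u →
        ∃ b : unitInterval, IsGreatest {t : unitInterval | u t ∈ frontier O} b ∧
          ∀ q' ∈ openSegment ℝ (u b) q, q' ∈ Obstacle.uniqueSet O p :=
  ⟨Obstacle.nonuniqueSet_subset_frontier hO, Obstacle.interior_nonuniqueSet hO,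
    fun _ hq hseg _ hu => hu.exists_isGreatest_contact hO hq hseg⟩
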